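/- Let $X$ be an arcwise-connected topological space, $X=U\cup V$ with $U,V\subset X$ open and arcwise-connected, and suppose that $U\cap V$ has exactly $m\ge 1$ arcwise-connected components $C_1,\dots,C_m$ (its path components). Choose points $x_{i-1}\in C_i$ for $1\le i\le m$ and, for $2\le i\le m$, paths $a(x_0,x_{i-1})$ in $U$ and $b(x_0,x_{i-1})$ in $V$, each from $x_0$ to $x_{i-1}$. Let - $B_m^T$ be the topological graph formed by these arcs: it has vertices $x_0,\dots,x_{m-1}$ and, for each $2\le i\le m$, two parallel edges $a(x_0,x_{i-1})$ and $b(x_0,x_{i-1})$ joining $x_0$ to $x_{i-1}$; - $U^E$ be the space obtained from $U$ by attaching, for each $2\le i\le m$, an arc $b(x_0,x_{i-1})$ along its end points $x_0$ and $x_{i-1}$; - $U^E\cap V$ be the space obtained from $U\cap V$ by attaching the same arcs; - $C_1^E=C_1$ and, for $2\le i\le m$, $C_i^E=C_i\cup b(x_0,x_{i-1})$, the space obtained from $C_i\cup\{x_0\}$ by attaching the $i$-th arc. Let $i_1^E:\pi_1(U^E\cap V,x_0)\to\pi_1(U^E,x_0)$ and $i_2^E:\pi_1(U^E\cap V,x_0)\to\pi_1(V,x_0)$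 be induced by the inclusions, where for $i_2^E$ the attached arcs are mapped to the paths $b(x_0,x_{i-1})$ of $V$. Let $\prod_{i=1}^m\pi_1(C_i^E,x_0)$ denote the free product of these groups; its elements are read in $\pi_1(U^E\cap V,x_0)$ through the inclusions $C_i^E\subset U^E\cap V$. Then the canonical homomorphism $\theta:\pi_1(U,x_0)*\pi_1(B_m^T,x_0)\to\pi_1(U^E,x_0)$, induced by $U\subset U^E$ and by the map $B_m^T\to U^E$ that sends the edges $a(x_0,x_{i-1})$ to the given paths of $U$ and the edges $b(x_0,x_{i-1})$ to the attached arcs, is an isomorphism, and, reading $i_1^E(g)$ in $\pi_1(U,x_0)*\pi_1(B_m^T,x_0)$ through $\theta$, $$\pi_1(X,x_0)\cong\frac{\pi_1(U,x_0)*\pi_1(V,x_0)*\pi_1(B_m^T,x_0)}{\left[(i_1^{E}(g))^{-1}\cdot i_2^E(g)\ \middle|\ g\in\prod_{i=1}^m\pi_1(C_i^E,x_0)\right]},$$ where $[A]$ denotes the smallest normal subgroup containing $A$. -/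

import Mathlib

/-! ### Attaching arcs to a space, and topological graphs -/

/-- The identifications made when an arc is attached to `Y` for every `j : J`: the start of the
`j`-th copy of the unit interval is glued to `s j` and its end to `t j`. -/
inductive ArcAttach.Rel {J Y : Type*} (s t : J → Y) :
    Y ⊕ (Σ _ : J, unitInterval) → Y ⊕ (Σ _ : J, unitInterval) → Prop
  | source (j : J) : ArcAttach.Rel s t (Sum.inr ⟨j, 0⟩) (Sum.inl (s j))
  | target (j : J) : ArcAttach.Rel s t (Sum.inr ⟨j, 1⟩) (Sum.inl (t j))

/-- The space obtained from `Y` by attaching, for every `j : J`, an arc from `s j` to `t j`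
(the quotient of the disjoint union of `Y` and of `J` copies of the unit interval). -/
def ArcAttach {J Y : Type*} (s t : J → Y) : Type _ :=
  Quot (ArcAttach.Rel s t)

namespace ArcAttach

/-- `ArcAttach s t` carries the quotient topology. -/
instance instTopologicalSpace {J Y : Type*} [TopologicalSpace Y] (s t : J → Y) :
    TopologicalSpace (ArcAttach s t) :=
  @instTopologicalSpaceQuot _ (ArcAttach.Rel s t)
    (@instTopologicalSpaceSum Y (Σ _ : J, unitInterval) _ inferInstance)

/-- The canonical map from `Y` to the space with the arcs attached. -/
def incl {J Y : Type*} [TopologicalSpace Y] (s t : J → Y) : C(Y, ArcAttach s t) where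
  toFun y := Quot.mk _ (Sum.inl y)
  continuous_toFun := continuous_quot_mk.comp continuous_inl

/-- The `j`-th attached arc. -/
def arc {J Y : Type*} [TopologicalSpace Y] (s t : J → Y) (j : J) :
    Path (incl s t (s j)) (incl s t (t j)) where
  toFun r := Quot.mk _ (Sum.inr ⟨j, r⟩)
  continuous_toFun := continuous_quot_mk.comp (continuous_inr.comp continuous_sigmaMk)
  source' := Quot.sound (Rel.source j)
  target' := Quot.sound (Rel.target j)

/-- The continuous map out of the space with the arcs attached which is `f` on `Y` and runs
along the path `p j` on the `j`-th attached arc. -/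
def lift {J Y Z : Type*} [TopologicalSpace Y] [TopologicalSpace Z] {s t : J → Y}
    (f : C(Y, Z)) (p : ∀ j, Path (f (s j)) (f (t j))) : C(ArcAttach s t, Z) where
  toFun := Quot.lift (Sum.elim f fun e => p e.1 e.2) (by
    rintro _ _ (j | j)
    · exact (p j).source
    · exact (p j).target)
  continuous_toFun := continuous_quot_lift _ <|
    f.continuous.sumElim (continuous_sigma fun j => (p j).continuous)

end ArcAttach

/-- The topological graph `B_m^T` for `m = n + 1`: its vertices are `0, …, n`, and for every
`j : Fin n` there are two parallel edges from the vertex `0` to the vertex `j + 1`, the edge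
`Sum.inl j` (standing for the arc `a`) and the edge `Sum.inr j` (standing for the arc `b`). -/
abbrev GraphB (n : ℕ) : Type :=
  ArcAttach (Y := Fin (n + 1)) (fun _ : Fin n ⊕ Fin n => 0) (Sum.elim Fin.succ Fin.succ)

/-- The vertex `0` of `B_m^T`, its base point. -/
abbrev GraphB.base (n : ℕ) : GraphB n := ArcAttach.incl _ _ 0

/-! ### The spaces and homomorphisms attached to a cover by two sets

`U` and `V` are subsets of `X`, the points `x 0, …, x n` of `U ∩ V` are chosen one in each path
component of `U ∩ V`, and `a j`, `b j` are paths from `x 0` to `x (j + 1)` in `U` and in `V`. -/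

namespace SplitCover

/-- A point of `U ∩ V`, as a point of `U`. -/
abbrev toU {X : Type*} [TopologicalSpace X] (U V : Set X) : C(↥(U ∩ V), ↥U) where
  toFun := Set.inclusion Set.inter_subset_left
  continuous_toFun := continuous_inclusion _

/-- A point of `U ∩ V`, as a point of `V`. -/
abbrev toV {X : Type*} [TopologicalSpace X] (U V : Set X) : C(↥(U ∩ V), ↥V) where
  toFun := Set.inclusion Set.inter_subset_right
  continuous_toFun := continuous_inclusion _

/-- `U^E`: the space `U` with an arc from `x 0` to `x (j + 1)` attached for each `j`. -/
abbrev UE {X : Type*} [TopologicalSpace X] {U V : Set X} {n : ℕ}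
    (x : Fin (n + 1) → ↥(U ∩ V)) : Type _ :=
  ArcAttach (fun _ : Fin n => toU U V (x 0)) (fun j => toU U V (x j.succ))

/-- The base point of `U^E`. -/
abbrev UE.base {X : Type*} [TopologicalSpace X] {U V : Set X} {n : ℕ}
    (x : Fin (n + 1) → ↥(U ∩ V)) : UE x := ArcAttach.incl _ _ (toU U V (x 0))

/-- `U^E ∩ V`: the space `U ∩ V` with an arc from `x 0` to `x (j + 1)` attached for each `j`
(these arcs stand for arcs in `V`, so they are kept when intersecting `U^E` with `V`). -/
abbrev WE {X : Type*} {U V : Set X} {n : ℕ} (x : Fin (n + 1) → ↥(U ∩ V)) : Type _ :=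
  ArcAttach (fun _ : Fin n => x 0) (fun j => x j.succ)

/-- The base point of `U^E ∩ V`. -/
abbrev WE.base {X : Type*} [TopologicalSpace X] {U V : Set X} {n : ℕ}
    (x : Fin (n + 1) → ↥(U ∩ V)) : WE x := ArcAttach.incl _ _ (x 0)

/-- The path component of `x i` in `U ∩ V`, together with the point `x 0`. -/
abbrev CBase {X : Type*} [TopologicalSpace X] {U V : Set X} {n : ℕ}
    (x : Fin (n + 1) → ↥(U ∩ V)) (i : Fin (n + 1)) : Set ↥(U ∩ V) :=
  pathComponent (x i) ∪ {x 0}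

/-- The point `x 0` in the path component of `x i` enlarged by `x 0`. -/
abbrev CBase.source {X : Type*} [TopologicalSpace X] {U V : Set X} {n : ℕ}
    (x : Fin (n + 1) → ↥(U ∩ V)) (i : Fin (n + 1)) : ↥(CBase x i) :=
  ⟨x 0, Or.inr rfl⟩

/-- The point `x i` in the path component of `x i` enlarged by `x 0`. -/
abbrev CBase.target {X : Type*} [TopologicalSpace X] {U V : Set X} {n : ℕ}
    (x : Fin (n + 1) → ↥(U ∩ V)) (i : Fin (n + 1)) : ↥(CBase x i) :=
  ⟨x i, Or.inl (mem_pathComponent_self (x i))⟩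

/-- `C_i^E`: the path component of `x i` in `U ∩ V`, together with an arc from `x 0` to `x i`.
For `i = 0` there is no arc to attach (no `j` satisfies `j.succ = 0`), and this is the path
component of `x 0`; for `i = j.succ` exactly one arc is attached. -/
abbrev CE {X : Type*} [TopologicalSpace X] {U V : Set X} {n : ℕ}
    (x : Fin (n + 1) → ↥(U ∩ V)) (i : Fin (n + 1)) : Type _ :=
  ArcAttach (fun _ : {j : Fin n // j.succ = i} => CBase.source x i)
    (fun _ => CBase.target x i)

/-- The base point `x 0` of `C_i^E`. -/
abbrev CE.base {X : Type*} [TopologicalSpace X] {U V : Set X} {n : ℕ}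
    (x : Fin (n + 1) → ↥(U ∩ V)) (i : Fin (n + 1)) : CE x i :=
  ArcAttach.incl _ _ (CBase.source x i)

/-- The inclusion of `C_i^E` in `U^E ∩ V`. -/
def inclCE {X : Type*} [TopologicalSpace X] {U V : Set X} {n : ℕ}
    (x : Fin (n + 1) → ↥(U ∩ V)) (i : Fin (n + 1)) : C(CE x i, WE x) :=
  ArcAttach.lift
    ((ArcAttach.incl (fun _ : Fin n => x 0) (fun j => x j.succ)).comp
      ⟨Subtype.val, continuous_subtype_val⟩)
    (fun j => (ArcAttach.arc (fun _ : Fin n => x 0) (fun j => x j.succ) j.1).cast rfl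
      (congrArg (fun k => ArcAttach.incl _ _ (x k)) j.2.symm))

/-- The inclusion of `U^E ∩ V` in `U^E`. -/
def inclWU {X : Type*} [TopologicalSpace X] {U V : Set X} {n : ℕ}
    (x : Fin (n + 1) → ↥(U ∩ V)) : C(WE x, UE x) :=
  ArcAttach.lift ((ArcAttach.incl _ _).comp (toU U V)) (fun j => ArcAttach.arc _ _ j)

/-- The inclusion of `U^E ∩ V` in `V`, where the `j`-th arc is the path `b j` of `V`. -/
def inclWV {X : Type*} [TopologicalSpace X] {U V : Set X} {n : ℕ}
    (x : Fin (n + 1) → ↥(U ∩ V)) (b : ∀ j : Fin n, Path (toV U V (x 0)) (toV U V (x j.succ))) :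
    C(WE x, ↥V) :=
  ArcAttach.lift (toV U V) b

/-- The map from `B_m^T` to `U^E` sending the vertex `i` to `x i`, the `j`-th edge of the first
kind to the path `a j` of `U`, and the `j`-th edge of the second kind to the attached arc. -/
def inclBU {X : Type*} [TopologicalSpace X] {U V : Set X} {n : ℕ}
    (x : Fin (n + 1) → ↥(U ∩ V)) (a : ∀ j : Fin n, Path (toU U V (x 0)) (toU U V (x j.succ))) :
    C(GraphB n, UE x) :=
  ArcAttach.lift ⟨fun i => ArcAttach.incl _ _ (toU U V (x i)), continuous_of_discreteTopology⟩
    (fun k => match k with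
      | Sum.inl j => (a j).map (ArcAttach.incl _ _).continuous
      | Sum.inr j => ArcAttach.arc _ _ j)

/-- The canonical homomorphism `∏ π₁(C_i^E, x₀) → π₁(U^E ∩ V, x₀)`, the product being the free
product of the groups, induced by the inclusions. -/
noncomputable def fromC {X : Type*} [TopologicalSpace X] {U V : Set X} {n : ℕ}
    (x : Fin (n + 1) → ↥(U ∩ V)) :
    Monoid.CoprodI (fun i => FundamentalGroup (CE x i) (CE.base x i)) →*
      FundamentalGroup (WE x) (WE.base x) :=
  Monoid.CoprodI.lift (fun i => FundamentalGroup.map (inclCE x i) (CE.base x i))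

/-- `i_1^E : π₁(U^E ∩ V, x₀) → π₁(U^E, x₀)`, induced by the inclusion. -/
noncomputable def i1E {X : Type*} [TopologicalSpace X] {U V : Set X} {n : ℕ}
    (x : Fin (n + 1) → ↥(U ∩ V)) :
    FundamentalGroup (WE x) (WE.base x) →* FundamentalGroup (UE x) (UE.base x) :=
  FundamentalGroup.map (inclWU x) (WE.base x)

/-- `i_2^E : π₁(U^E ∩ V, x₀) → π₁(V, x₀)`, induced by the inclusion. -/
noncomputable def i2E {X : Type*} [TopologicalSpace X] {U V : Set X} {n : ℕ}
    (x : Fin (n + 1) → ↥(U ∩ V)) (b : ∀ j : Fin n, Path (toV U V (x 0)) (toV U V (x j.succ))) :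
    FundamentalGroup (WE x) (WE.base x) →* FundamentalGroup ↥V (toV U V (x 0)) :=
  FundamentalGroup.map (inclWV x b) (WE.base x)

/-- The canonical homomorphism `π₁(U, x₀) * π₁(B_m^T, x₀) → π₁(U^E, x₀)`. -/
noncomputable def theta {X : Type*} [TopologicalSpace X] {U V : Set X} {n : ℕ}
    (x : Fin (n + 1) → ↥(U ∩ V)) (a : ∀ j : Fin n, Path (toU U V (x 0)) (toU U V (x j.succ))) :
    Monoid.Coprod (FundamentalGroup ↥U (toU U V (x 0)))
        (FundamentalGroup (GraphB n) (GraphB.base n)) →*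
      FundamentalGroup (UE x) (UE.base x) :=
  Monoid.Coprod.lift
    (FundamentalGroup.map (ArcAttach.incl _ _) (toU U V (x 0)))
    (FundamentalGroup.map (inclBU x a) (GraphB.base n))

/-- The free product `π₁(U, x₀) * π₁(V, x₀) * π₁(B_m^T, x₀)`. -/
abbrev FreeProd {X : Type*} [TopologicalSpace X] {U V : Set X} {n : ℕ}
    (x : Fin (n + 1) → ↥(U ∩ V)) : Type _ :=
  Monoid.Coprod
    (Monoid.Coprod (FundamentalGroup ↥U (toU U V (x 0))) (FundamentalGroup ↥V (toV U V (x 0))))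
    (FundamentalGroup (GraphB n) (GraphB.base n))

/-- The canonical homomorphism from `π₁(U, x₀) * π₁(B_m^T, x₀)` to
`π₁(U, x₀) * π₁(V, x₀) * π₁(B_m^T, x₀)`. -/
noncomputable def embUB {X : Type*} [TopologicalSpace X] {U V : Set X} {n : ℕ}
    (x : Fin (n + 1) → ↥(U ∩ V)) :
    Monoid.Coprod (FundamentalGroup ↥U (toU U V (x 0)))
        (FundamentalGroup (GraphB n) (GraphB.base n)) →* FreeProd x :=
  Monoid.Coprod.lift (Monoid.Coprod.inl.comp Monoid.Coprod.inl) Monoid.Coprod.inr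

/-- The canonical homomorphism from `π₁(V, x₀)` to `π₁(U, x₀) * π₁(V, x₀) * π₁(B_m^T, x₀)`. -/
noncomputable def embV {X : Type*} [TopologicalSpace X] {U V : Set X} {n : ℕ}
    (x : Fin (n + 1) → ↥(U ∩ V)) :
    FundamentalGroup ↥V (toV U V (x 0)) →* FreeProd x :=
  Monoid.Coprod.inl.comp Monoid.Coprod.inr

/-- The elements `(i_1^E g)⁻¹ · i_2^E g` of `π₁(U, x₀) * π₁(V, x₀) * π₁(B_m^T, x₀)`, for `g` in
the free product of the `π₁(C_i^E, x₀)`. Here `i_1^E g`, an element of `π₁(U^E, x₀)`, is read in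
`π₁(U, x₀) * π₁(B_m^T, x₀)` through `theta`, that is, as the element `w` with
`theta w = i_1^E g`. -/
def relators {X : Type*} [TopologicalSpace X] {U V : Set X} {n : ℕ}
    (x : Fin (n + 1) → ↥(U ∩ V))
    (a : ∀ j : Fin n, Path (toU U V (x 0)) (toU U V (x j.succ)))
    (b : ∀ j : Fin n, Path (toV U V (x 0)) (toV U V (x j.succ))) : Set (FreeProd x) :=
  {r | ∃ (g : Monoid.CoprodI (fun i => FundamentalGroup (CE x i) (CE.base x i)))
      (w : Monoid.Coprod (FundamentalGroup ↥U (toU U V (x 0)))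
        (FundamentalGroup (GraphB n) (GraphB.base n))),
      theta x a w = i1E x (fromC x g) ∧
      r = (embUB x w)⁻¹ * embV x (i2E x b (fromC x g))}

end SplitCover

/-! A homomorphism out of a fundamental group is handled here as a `PathCocycle`, that is, a functor
from the fundamental groupoid to a group. Every path has a value, so no base point has to be carried
along, and van Kampen becomes a gluing statement: by dyadic subdivision a cocycle exists, and is
determined, as soon as it is given on the members of an open cover (`exists_of_local`,
`eq_of_local`, `exists_glue`). Choosing classes of paths from the base point turns paths into loops
(`tree`), and on loops this recovers their classes (`tree_loop`).

For a space with arcs attached, a cocycle on the given space extends with arbitrary values on the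
arcs (`exists_cocycle`), and these data determine it on paths with ends in the given space
(`cocycle_eq`). So the inverse of `theta` can be written down: the edges `a` form a maximal tree of
the graph, and the `j`-th attached arc goes to the class of the loop "out along `b`, back along
`a`".

For `X`, the paths `b` define `mapUE`, and the two routes from `U^E ∩ V` to `X`, through `U^E` and
through `V`, coincide; hence the relators die in the fundamental group of `X`. Conversely, the
cocycles on `U` and `V` with values in the quotient agree on `U ∩ V`: with suitable choices of path
classes, each path of `U ∩ V` closes up to a loop from a single `C_i^E`, where the relators apply.
They glue to a cocycle on `X`, whose homomorphism is the inverse. -/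

open scoped unitInterval

noncomputable section

/-! ### Dyadic subdivision -/

section Dyadic

variable {X ι κ K : Type*} [TopologicalSpace X] [PseudoMetricSpace K] [CompactSpace K]

/-- A property of maps from a compact space `K` holds for all maps if it holds for the maps into a
member of an open cover, and if it can be checked on the restrictions along contractions `q k`. -/
theorem dyadic_induction [Nonempty K] {O : ι → Set X} (hO : ∀ i, IsOpen (O i))
    (hcov : ∀ x, ∃ i, x ∈ O i) (q : κ → C(K, K)) (hdiam : ∀ x y : K, dist x y ≤ 1)
    (hq : ∀ k x y, dist (q k x) (q k y) ≤ dist x y / 2) {Q : C(K, X) → Prop}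
    (hloc : ∀ i f, (∀ t, f t ∈ O i) → Q f) (hstep : ∀ f, (∀ k, Q (f.comp (q k))) → Q f)
    (f : C(K, X)) : Q f := by
  have key : ∀ n : ℕ, ∀ f : C(K, X),
      (∀ s, ∃ i, ∀ t, dist t s < 2 * (1 / 2 : ℝ) ^ n → f t ∈ O i) → Q f := by
    intro n
    induction n with
    | zero =>
      intro f hf
      obtain ⟨i, hi⟩ := hf (Classical.arbitrary K)
      refine hloc i f fun t => hi t ?_
      have := hdiam t (Classical.arbitrary K)
      norm_num
      linarith
    | succ n ih =>
      intro f hf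
      refine hstep f fun k => ih _ fun s => ?_
      obtain ⟨i, hi⟩ := hf (q k s)
      refine ⟨i, fun t ht => hi _ ?_⟩
      have := hq k t s
      rw [pow_succ]
      linarith
  obtain ⟨δ, hδ, h⟩ := lebesgue_number_lemma_of_metric (s := (Set.univ : Set K))
    (c := fun i => f ⁻¹' O i) isCompact_univ (fun i => (hO i).preimage f.continuous)
    (fun t _ => Set.mem_iUnion.2 (hcov (f t)))
  obtain ⟨n, hn⟩ := exists_pow_lt_of_lt_one (half_pos hδ) (by norm_num : (1 / 2 : ℝ) < 1)
  refine key n f fun s => ?_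
  obtain ⟨i, hi⟩ := h s trivial
  exact ⟨i, fun t ht => hi (Metric.mem_ball.2 (by linarith))⟩

end Dyadic

/-! ### Path cocycles -/

namespace PathCocycle

/-- The first half `t ↦ t / 2` (for `false`) and the second half `t ↦ (t + 1) / 2` (for `true`) of
the unit interval. -/
def half (k : Bool) : C(I, I) where
  toFun t := ⟨(t + (if k then 1 else 0)) / 2, by
    have := t.2.1
    have := t.2.2
    split_ifs <;> constructor <;> linarith⟩
  continuous_toFun := by fun_prop

theorem coe_half_false (t : I) : (half false t : ℝ) = t / 2 := by simp [half]

theorem coe_half_true (t : I) : (half true t : ℝ) = (t + 1) / 2 := by simp [half]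

@[simp] theorem half_false_zero : half false 0 = 0 := by ext; simp [half]

@[simp] theorem half_true_one : half true 1 = 1 := by ext; simp [half]

theorem half_true_zero : half true 0 = half false 1 := by ext; simp [half]

theorem dist_half (k : Bool) (s t : I) : dist (half k s) (half k t) = dist s t / 2 := by
  simp only [Subtype.dist_eq, half, ContinuousMap.coe_mk, Real.dist_eq]
  rw [← abs_two (α := ℝ), ← abs_div, abs_two]
  congr 1
  ring

theorem unitInterval_dist_le_one (s t : I) : dist s t ≤ 1 := by
  rw [Subtype.dist_eq, Real.dist_eq, abs_le]
  have := s.2.1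
  have := s.2.2
  have := t.2.1
  have := t.2.2
  constructor <;> linarith

/-- The bottom (for `false`) and the top (for `true`) side of the unit square. -/
def hside (k : Bool) : C(I, I × I) := ⟨fun t => (t, if k then 1 else 0), by fun_prop⟩

/-- The left (for `false`) and the right (for `true`) side of the unit square. -/
def vside (k : Bool) : C(I, I × I) := ⟨fun t => (if k then 1 else 0, t), by fun_prop⟩

end PathCocycle

/-- A path cocycle on `X` with values in `G`: a function on the maps from the unit interval to `X`
that is multiplicative under cutting a path in two halves, and whose values on the sides of a
square in `X` commute. This is a functor from the fundamental groupoid of `X` to `G`, in the order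
of composition used by `FundamentalGroup`. -/
structure PathCocycle (X : Type*) [TopologicalSpace X] (G : Type*) [Group G] where
  /-- The value of a cocycle on a path. -/
  toFun : C(I, X) → G
  map_halves' (f : C(I, X)) : toFun f =
    toFun (f.comp (PathCocycle.half true)) * toFun (f.comp (PathCocycle.half false))
  map_square' (H : C(I × I, X)) :
    toFun (H.comp (PathCocycle.vside true)) * toFun (H.comp (PathCocycle.hside false)) =
      toFun (H.comp (PathCocycle.hside true)) * toFun (H.comp (PathCocycle.vside false))

namespace PathCocycle

variable {X Y : Type*} [TopologicalSpace X] [TopologicalSpace Y]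
  {G G' : Type*} [Group G] [Group G']

instance : CoeFun (PathCocycle X G) fun _ => C(I, X) → G := ⟨toFun⟩

theorem map_halves (φ : PathCocycle X G) (f : C(I, X)) :
    φ f = φ (f.comp (half true)) * φ (f.comp (half false)) := φ.map_halves' f

theorem map_square (φ : PathCocycle X G) (H : C(I × I, X)) :
    φ (H.comp (vside true)) * φ (H.comp (hside false)) =
      φ (H.comp (hside true)) * φ (H.comp (vside false)) := φ.map_square' H

/-- The pullback of a cocycle along a continuous map. -/
def comap (φ : PathCocycle Y G) (g : C(X, Y)) : PathCocycle X G where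
  toFun f := φ (g.comp f)
  map_halves' f := φ.map_halves (g.comp f)
  map_square' H := φ.map_square (g.comp H)

theorem comap_apply (φ : PathCocycle Y G) (g : C(X, Y)) (f : C(I, X)) :
    φ.comap g f = φ (g.comp f) := rfl

/-- The image of a cocycle under a group homomorphism. -/
def push (φ : PathCocycle X G) (u : G →* G') : PathCocycle X G' where
  toFun f := u (φ f)
  map_halves' f := by rw [φ.map_halves, map_mul]
  map_square' H := by rw [← map_mul, ← map_mul, φ.map_square]

theorem push_apply (φ : PathCocycle X G) (u : G →* G') (f : C(I, X)) :
    φ.push u f = u (φ f) := rfl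

-- Both halves of a constant path are that path, so its value is idempotent.
@[simp] theorem map_const (φ : PathCocycle X G) (p : X) : φ (ContinuousMap.const I p) = 1 := by
  have h := φ.map_halves (ContinuousMap.const I p)
  simpa using h

/-- Induction on paths: a property of paths that holds for the paths in a member of an open cover
and that can be checked on the two halves of a path holds for all paths. -/
theorem path_induction {ι : Type*} {O : ι → Set X} (hO : ∀ i, IsOpen (O i))
    (hcov : ∀ x, ∃ i, x ∈ O i) {Q : C(I, X) → Prop} (hloc : ∀ i f, (∀ t, f t ∈ O i) → Q f)
    (hstep : ∀ f, Q (f.comp (half false)) → Q (f.comp (half true)) → Q f) (f : C(I, X)) : Q f :=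
  dyadic_induction hO hcov half unitInterval_dist_le_one (fun k s t => (dist_half k s t).le) hloc
    (fun f h => hstep f (h false) (h true)) f

/-- The quarters of the unit square. -/
def quarter (k : Bool × Bool) : C(I × I, I × I) := (half k.1).prodMap (half k.2)

theorem square_induction {ι : Type*} {O : ι → Set X} (hO : ∀ i, IsOpen (O i))
    (hcov : ∀ x, ∃ i, x ∈ O i) {Q : C(I × I, X) → Prop} (hloc : ∀ i H, (∀ t, H t ∈ O i) → Q H)
    (hstep : ∀ H, (∀ k, Q (H.comp (quarter k))) → Q H) (H : C(I × I, X)) : Q H := by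
  refine dyadic_induction hO hcov quarter (fun s t => ?_) (fun k s t => ?_) hloc hstep H
  · exact max_le (unitInterval_dist_le_one _ _) (unitInterval_dist_le_one _ _)
  · simp only [Prod.dist_eq, quarter, ContinuousMap.prodMap_apply, Prod.map, dist_half]
    exact (max_div_div_right (by norm_num) _ _).le

theorem hside_half (k l : Bool) : (hside k).comp (half l) = (quarter (l, k)).comp (hside k) := by
  ext t <;> cases k <;> simp [hside, quarter]

theorem vside_half (k l : Bool) : (vside k).comp (half l) = (quarter (k, l)).comp (vside k) := by
  ext t <;> cases k <;> simp [vside, quarter]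

theorem quarter_hside (k : Bool) :
    (quarter (k, true)).comp (hside false) = (quarter (k, false)).comp (hside true) := by
  ext t <;> simp [hside, quarter, half_true_zero]

theorem quarter_vside (k : Bool) :
    (quarter (true, k)).comp (vside false) = (quarter (false, k)).comp (vside true) := by
  ext t <;> simp [vside, quarter, half_true_zero]

/-! ### Cocycles from local data. -/

section Local

variable {ι : Type*} {O : ι → Set X}

/-- All pieces of length `2⁻ⁿ` of the path lie in a member of `O`. -/
def IsFine (O : ι → Set X) : ℕ → C(I, X) → Prop
  | 0, f => ∃ i, ∀ t, f t ∈ O i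
  | n + 1, f => IsFine O n (f.comp (half false)) ∧ IsFine O n (f.comp (half true))

theorem IsFine.succ {n : ℕ} : ∀ {f : C(I, X)}, IsFine O n f → IsFine O (n + 1) f := by
  induction n with
  | zero => exact fun ⟨i, hi⟩ => ⟨⟨i, fun t => hi _⟩, ⟨i, fun t => hi _⟩⟩
  | succ n ih => exact fun h => ⟨ih h.1, ih h.2⟩

theorem IsFine.mono {n m : ℕ} (h : n ≤ m) {f : C(I, X)} (hf : IsFine O n f) : IsFine O m f := by
  induction h with
  | refl => exact hf
  | step _ ih => exact ih.succ

theorem exists_isFine (hO : ∀ i, IsOpen (O i)) (hcov : ∀ x, ∃ i, x ∈ O i) (f : C(I, X)) :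
    ∃ n, IsFine O n f := by
  refine path_induction (Q := fun f => ∃ n, IsFine O n f) hO hcov (fun i f hf => ⟨0, i, hf⟩) ?_ f
  rintro f ⟨n, hn⟩ ⟨m, hm⟩
  exact ⟨max n m + 1, hn.mono (le_max_left _ _), hm.mono (le_max_right _ _)⟩

/-- The product of the values of `w` on the pieces of length `2⁻ⁿ` of a path. -/
def subdivide (w : C(I, X) → G) : ℕ → C(I, X) → G
  | 0, f => w f
  | n + 1, f => subdivide w n (f.comp (half true)) * subdivide w n (f.comp (half false))

variable {w : C(I, X) → G}

/-- The extra subdivision only cuts pieces that already lie in one member of the cover, where `w` is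
multiplicative. -/
theorem subdivide_succ
    (hw : ∀ i f, (∀ t, f t ∈ O i) → w f = w (f.comp (half true)) * w (f.comp (half false)))
    {n : ℕ} : ∀ {f : C(I, X)}, IsFine O n f → subdivide w (n + 1) f = subdivide w n f := by
  induction n with
  | zero => exact fun ⟨i, hi⟩ => (hw i _ hi).symm
  | succ n ih =>
    intro f hf
    rw [subdivide, ih hf.1, ih hf.2]
    rfl

theorem subdivide_eq
    (hw : ∀ i f, (∀ t, f t ∈ O i) → w f = w (f.comp (half true)) * w (f.comp (half false)))
    {n m : ℕ} {f : C(I, X)} (hn : IsFine O n f) (hm : IsFine O m f) :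
    subdivide w n f = subdivide w m f := by
  have key : ∀ {n m : ℕ}, n ≤ m → IsFine O n f → subdivide w m f = subdivide w n f := by
    intro n m h hf
    induction h with
    | refl => rfl
    | step h ih => exact (subdivide_succ hw (hf.mono h)).trans ih
  rcases le_total n m with h | h
  · exact (key h hn).symm
  · exact key h hm

theorem square_of_local (hO : ∀ i, IsOpen (O i)) (hcov : ∀ x, ∃ i, x ∈ O i) {φ : C(I, X) → G}
    (hhalf : ∀ f, φ f = φ (f.comp (half true)) * φ (f.comp (half false)))
    (hsq : ∀ i (H : C(I × I, X)), (∀ t, H t ∈ O i) →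
      φ (H.comp (vside true)) * φ (H.comp (hside false)) =
        φ (H.comp (hside true)) * φ (H.comp (vside false))) (H : C(I × I, X)) :
    φ (H.comp (vside true)) * φ (H.comp (hside false)) =
        φ (H.comp (hside true)) * φ (H.comp (vside false)) := by
  refine square_induction (Q := fun H => φ (H.comp (vside true)) * φ (H.comp (hside false)) =
    φ (H.comp (hside true)) * φ (H.comp (vside false))) hO hcov hsq (fun H hH => ?_) H
  rw [hhalf (H.comp (vside true)), hhalf (H.comp (vside false)), hhalf (H.comp (hside true)),
    hhalf (H.comp (hside false))]
  simp only [ContinuousMap.comp_assoc, hside_half, vside_half] at hH ⊢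
  have h00 := hH (false, false)
  have h10 := hH (true, false)
  have h01 := hH (false, true)
  have h11 := hH (true, true)
  rw [quarter_vside] at h10 h11
  rw [quarter_hside] at h01 h11
  -- The route along the bottom and up the right side is pushed across the quarters in turn: lower
  -- right, lower left, upper right, upper left.
  rw [mul_assoc, ← mul_assoc _ _ (φ (H.comp ((quarter (false, false)).comp (hside false)))),
    h10, mul_assoc, h00, ← mul_assoc, ← mul_assoc, h11, mul_assoc, mul_assoc, mul_assoc,
    ← mul_assoc _ _ (φ (H.comp ((quarter (false, false)).comp (vside false)))), h01, mul_assoc]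

/-- A function on paths that satisfies the conditions on a cocycle inside each member of an open
cover agrees there with a cocycle. -/
theorem exists_of_local (hO : ∀ i, IsOpen (O i)) (hcov : ∀ x, ∃ i, x ∈ O i)
    (hw : ∀ i f, (∀ t, f t ∈ O i) → w f = w (f.comp (half true)) * w (f.comp (half false)))
    (hsq : ∀ i (H : C(I × I, X)), (∀ t, H t ∈ O i) →
      w (H.comp (vside true)) * w (H.comp (hside false)) =
        w (H.comp (hside true)) * w (H.comp (vside false))) :
    ∃ φ : PathCocycle X G, ∀ i f, (∀ t, f t ∈ O i) → φ f = w f := by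
  -- The cocycle is the product of `w` over any sufficiently fine subdivision; by `subdivide_eq` the
  -- level does not matter, so a path and its halves can be compared at a common level.
  choose N hN using exists_isFine hO hcov
  have heq : ∀ {n f}, IsFine O n f → subdivide w (N f) f = subdivide w n f :=
    fun h => subdivide_eq hw (hN _) h
  have hval : ∀ i f, (∀ t, f t ∈ O i) → subdivide w (N f) f = w f :=
    fun i f h => heq (n := 0) ⟨i, h⟩
  have hhalf : ∀ f, subdivide w (N f) f = subdivide w (N (f.comp (half true))) (f.comp (half true))
      * subdivide w (N (f.comp (half false))) (f.comp (half false)) := by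
    intro f
    have h1 := (hN (f.comp (half false))).mono
      (le_max_left (N (f.comp (half false))) (N (f.comp (half true))))
    have h2 := (hN (f.comp (half true))).mono
      (le_max_right (N (f.comp (half false))) (N (f.comp (half true))))
    rw [heq (show IsFine O (_ + 1) f from ⟨h1, h2⟩), heq h1, heq h2]
    rfl
  refine ⟨⟨fun f => subdivide w (N f) f, hhalf, square_of_local hO hcov hhalf ?_⟩, hval⟩
  intro i H hH
  rw [hval i _ fun t => hH _, hval i _ fun t => hH _, hval i _ fun t => hH _,
    hval i _ fun t => hH _]
  exact hsq i H hH

/-- Two cocycles that agree on the paths in the members of an open cover are equal. -/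
theorem eq_of_local (hO : ∀ i, IsOpen (O i)) (hcov : ∀ x, ∃ i, x ∈ O i) {φ ψ : PathCocycle X G}
    (h : ∀ i f, (∀ t, f t ∈ O i) → φ f = ψ f) (f : C(I, X)) : φ f = ψ f :=
  path_induction hO hcov h (fun f h1 h2 => by rw [φ.map_halves, ψ.map_halves, h1, h2]) f

end Local

/-! ### Gluing cocycles over two open sets. -/

/-- A map with values in a set, as a map to the subtype. -/
def restrictRange {K : Type*} [TopologicalSpace K] {S : Set X} (f : C(K, X)) (h : ∀ t, f t ∈ S) :
    C(K, ↥S) := ⟨fun t => ⟨f t, h t⟩, by fun_prop⟩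

/-- The inclusion of a set. -/
abbrev inclusion (S : Set X) : C(↥S, X) := ⟨Subtype.val, continuous_subtype_val⟩

/-- **Van Kampen**: two cocycles on the members of an open cover that agree on their intersection
come from a cocycle. -/
theorem exists_glue {U V : Set X} (hU : IsOpen U) (hV : IsOpen V) (hUV : U ∪ V = Set.univ)
    (φ : PathCocycle ↥U G) (ψ : PathCocycle ↥V G)
    (h : ∀ (f : C(I, X)) (hfU : ∀ t, f t ∈ U) (hfV : ∀ t, f t ∈ V),
      φ (restrictRange f hfU) = ψ (restrictRange f hfV)) :
    ∃ χ : PathCocycle X G, (∀ f, χ ((inclusion U).comp f) = φ f) ∧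
      ∀ f, χ ((inclusion V).comp f) = ψ f := by
  classical
  -- The default value `1` plays no role: only paths inside `U` or inside `V` enter the local
  -- conditions.
  let w : C(I, X) → G := fun f => if hf : ∀ t, f t ∈ U then φ (restrictRange f hf) else
    if hf : ∀ t, f t ∈ V then ψ (restrictRange f hf) else 1
  have hwU : ∀ f (hf : ∀ t, f t ∈ U), w f = φ (restrictRange f hf) := fun f hf => dif_pos hf
  have hwV : ∀ f (hf : ∀ t, f t ∈ V), w f = ψ (restrictRange f hf) := by
    intro f hf
    by_cases hf' : ∀ t, f t ∈ U
    · rw [hwU f hf', h f hf' hf]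
    · simp only [w, dif_neg hf', dif_pos hf]
  have hO : ∀ k : Bool, IsOpen (bif k then U else V) := by rintro (_ | _) <;> assumption
  have hcov : ∀ x, ∃ k : Bool, x ∈ (bif k then U else V) := by
    intro x
    rcases (hUV ▸ Set.mem_univ x : x ∈ U ∪ V) with hx | hx
    · exact ⟨true, hx⟩
    · exact ⟨false, hx⟩
  obtain ⟨χ, hχ⟩ := exists_of_local (w := w) hO hcov
    (by
      rintro (_ | _) f hf
      · rw [hwV f hf, hwV (f.comp _) fun t => hf _, hwV (f.comp _) fun t => hf _]
        exact ψ.map_halves (restrictRange f hf)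
      · rw [hwU f hf, hwU (f.comp _) fun t => hf _, hwU (f.comp _) fun t => hf _]
        exact φ.map_halves (restrictRange f hf))
    (by
      rintro (_ | _) H hH
      · rw [hwV _ fun t => hH _, hwV _ fun t => hH _, hwV _ fun t => hH _, hwV _ fun t => hH _]
        exact ψ.map_square (restrictRange H hH)
      · rw [hwU _ fun t => hH _, hwU _ fun t => hH _, hwU _ fun t => hH _, hwU _ fun t => hH _]
        exact φ.map_square (restrictRange H hH))
  exact ⟨χ, fun f => (hχ true _ fun t => (f t).2).trans (hwU _ fun t => (f t).2),
    fun f => (hχ false _ fun t => (f t).2).trans (hwV _ fun t => (f t).2)⟩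

/-! ### Cocycles and homotopy classes of paths -/

theorem map_trans (φ : PathCocycle X G) {p q r : X} (γ : Path p q) (δ : Path q r) :
    φ (γ.trans δ) = φ δ * φ γ := by
  rw [φ.map_halves]
  congr 2
  · ext t
    have h : ((half true t : I) : ℝ) = (t + 1) / 2 := coe_half_true t
    simp only [ContinuousMap.comp_apply, ContinuousMap.coe_coe, Path.trans_apply, h]
    split_ifs with h'
    -- `Path.trans` puts the midpoint in its first branch, and the second half meets that branch
    -- only at its start.
    · have ht : t = 0 := by
        ext
        have := t.2.1
        simp only [Set.Icc.coe_zero]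
        linarith
      subst ht
      simp
    · congr 1
      ext
      simp
      ring
  · ext t
    have h : ((half false t : I) : ℝ) = t / 2 := coe_half_false t
    simp only [ContinuousMap.comp_apply, ContinuousMap.coe_coe, Path.trans_apply, h]
    rw [dif_pos (by have := t.2.2; linarith)]
    congr 1
    ext
    simp
    ring

theorem map_refl (φ : PathCocycle X G) (p : X) : φ (Path.refl p) = 1 := φ.map_const p

/-- A homotopy of paths is a square whose vertical sides are the two paths and whose horizontal
sides are constant. -/
theorem map_homotopic (φ : PathCocycle X G) {p q : X} {γ δ : Path p q} (h : γ.Homotopic δ) :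
    φ γ = φ δ := by
  obtain ⟨H⟩ := h
  have := φ.map_square (H : C(I × I, X))
  rw [show (H : C(I × I, X)).comp (vside true) = (δ : C(I, X)) by ext t; simp [vside],
    show (H : C(I × I, X)).comp (vside false) = (γ : C(I, X)) by ext t; simp [vside],
    show (H : C(I × I, X)).comp (hside true) = ContinuousMap.const I q by ext t; simp [hside],
    show (H : C(I × I, X)).comp (hside false) = ContinuousMap.const I p by ext t; simp [hside]]
    at this
  simpa using this.symm

/-- A map from the unit interval, as a path. -/
def asPath (f : C(I, X)) : Path (f 0) (f 1) := ⟨f, rfl, rfl⟩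

/-- The cocycle defined by a functorial function on paths. -/
def ofPath (F : ∀ {p q : X}, Path p q → G)
    (hF : ∀ {p q r : X} (γ : Path p q) (δ : Path q r), F (γ.trans δ) = F δ * F γ)
    (hF' : ∀ {p q : X} {γ δ : Path p q}, γ.Homotopic δ → F γ = F δ) : PathCocycle X G :=
  have key : ∀ {p q : X} (γ : Path p q), F (asPath (γ : C(I, X))) = F γ := by
    rintro p q ⟨f, rfl, rfl⟩
    rfl
  { toFun := fun f => F (asPath f)
    map_halves' := fun f => by
      let γ : Path (f 0) (f (half false 1)) := ⟨f.comp (half false), by simp, rfl⟩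
      let δ : Path (f (half false 1)) (f 1) :=
        ⟨f.comp (half true), by simp [half_true_zero], by simp⟩
      have h : f = (γ.trans δ : C(I, X)) := by
        ext t
        simp only [ContinuousMap.coe_coe, Path.trans_apply]
        split_ifs with h
        · show f t = f (half false _)
          congr 1
          ext
          rw [coe_half_false]
          simp
        · show f t = f (half true _)
          congr 1
          ext
          rw [coe_half_true]
          simp
      have h' := key (γ.trans δ)
      rw [← h, hF, ← key γ, ← key δ] at h'
      exact h'
    map_square' := fun H => by
      let b : Path ((0 : I), (0 : I)) (1, 0) := ⟨hside false, by simp [hside], by simp [hside]⟩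
      let t : Path ((0 : I), (1 : I)) (1, 1) := ⟨hside true, by simp [hside], by simp [hside]⟩
      let l : Path ((0 : I), (0 : I)) (0, 1) := ⟨vside false, by simp [vside], by simp [vside]⟩
      let r : Path ((1 : I), (0 : I)) (1, 1) := ⟨vside true, by simp [vside], by simp [vside]⟩
      have : ContractibleSpace I := (convex_Icc (0 : ℝ) 1).contractibleSpace ⟨0, by simp⟩
      -- In the simply connected unit square the two ways around the boundary are homotopic, and `H`
      -- carries the homotopy to `X`.
      have h := hF' ((SimplyConnectedSpace.paths_homotopic (b.trans r) (l.trans t)).map H)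
      rw [Path.map_trans, Path.map_trans, hF, hF, ← key, ← key, ← key, ← key] at h
      exact h }

/-- The class of a loop. -/
abbrev loop {p : X} (γ : Path p p) : FundamentalGroup X p := Path.Homotopic.Quotient.mk γ

/-- The homomorphism from the fundamental group defined by a cocycle. -/
def hom (φ : PathCocycle X G) (p : X) : FundamentalGroup X p →* G where
  toFun := Quotient.lift (fun γ : Path p p => φ γ) fun _ _ h => φ.map_homotopic h
  map_one' := φ.map_refl p
  map_mul' := by
    intro a b
    induction a using Quotient.inductionOn
    induction b using Quotient.inductionOn
    exact φ.map_trans _ _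

/-- The cocycle with values in the fundamental group obtained by closing up a path by means of
classes of paths from the base point. -/
def tree {x₀ : X} (c : ∀ p, Path.Homotopic.Quotient x₀ p) :
    PathCocycle X (FundamentalGroup X x₀) :=
  ofPath (fun {p q} γ => (c p).trans ((Path.Homotopic.Quotient.mk γ).trans (c q).symm))
    (fun {p q r} γ δ => by
      rw [FundamentalGroup.mul_def]
      simp only [Path.Homotopic.Quotient.mk_trans, Path.Homotopic.Quotient.trans_assoc]
      rw [← Path.Homotopic.Quotient.trans_assoc (c q).symm, Path.Homotopic.Quotient.symm_trans,
        Path.Homotopic.Quotient.refl_trans])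
    (fun h => by rw [Path.Homotopic.Quotient.eq.2 h])

theorem tree_apply {x₀ : X} (c : ∀ p, Path.Homotopic.Quotient x₀ p) {p q : X} (γ : Path p q) :
    tree c γ = ((c p).trans ((Path.Homotopic.Quotient.mk γ).trans (c q).symm) :
      Path.Homotopic.Quotient x₀ x₀) := by
  obtain ⟨f, rfl, rfl⟩ := γ
  rfl

/-- Naturality needs the choices `c` and `d` to match only at the two ends of the path. This is why
later choices are prescribed on selected points only. -/
theorem tree_map (g : C(X, Y)) {x₀ : X} {c : ∀ p, Path.Homotopic.Quotient x₀ p}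
    {d : ∀ p, Path.Homotopic.Quotient (g x₀) p} {p q : X} (γ : Path p q)
    (hp : d (g p) = (c p).map g) (hq : d (g q) = (c q).map g) :
    tree d (g.comp γ) = FundamentalGroup.map g x₀ (tree c γ) := by
  have h : g.comp γ = (γ.map g.continuous : C(I, Y)) := rfl
  rw [h, tree_apply, tree_apply, hp, hq]
  generalize c p = a
  generalize c q = b
  induction a using Quotient.inductionOn
  induction b using Quotient.inductionOn
  change _ = loop _
  change loop _ = loop _
  congr 1
  simp [Path.map_trans, Path.map_symm]

theorem tree_loop {x₀ : X} {c : ∀ p, Path.Homotopic.Quotient x₀ p}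
    (hc : c x₀ = Path.Homotopic.Quotient.refl x₀) (γ : Path x₀ x₀) : tree c γ = loop γ := by
  rw [tree_apply, hc]
  change (Path.Homotopic.Quotient.refl x₀).trans
    ((Path.Homotopic.Quotient.mk γ).trans (Path.Homotopic.Quotient.mk (Path.refl x₀).symm)) = _
  rw [Path.refl_symm, Path.Homotopic.Quotient.mk_refl, Path.Homotopic.Quotient.refl_trans,
    Path.Homotopic.Quotient.trans_refl]

end PathCocycle

/-! ### Cocycles on a space with arcs attached -/

namespace PathCocycle

variable {X : Type*} [TopologicalSpace X] {G : Type*} [Group G]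

/-- The cocycle measuring the variation of a function along a path. -/
def coboundary (h : X → G) : PathCocycle X G where
  toFun f := h (f 1) * (h (f 0))⁻¹
  map_halves' f := by simp [half_true_zero]
  map_square' H := by simp [hside, vside]

theorem coboundary_apply (h : X → G) (f : C(I, X)) : coboundary h f = h (f 1) * (h (f 0))⁻¹ := rfl

/-- The initial segment from `0` to `r` of the unit interval. -/
def seg (r : I) : C(I, I) := ⟨fun x => x * r, by fun_prop⟩

theorem seg_apply (r x : I) : seg r x = x * r := rfl

@[simp] theorem seg_zero : seg 0 = ContinuousMap.const I 0 := by ext; simp [seg]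

@[simp] theorem seg_one : seg 1 = ContinuousMap.id I := by ext; simp [seg]

/-- The square `(x, r) ↦ x * ρ r` has left side constant, right side `ρ`, and initial segments as
bottom and top; so every cocycle on the interval is a coboundary. -/
theorem map_interval (χ : PathCocycle I G) (ρ : C(I, I)) :
    χ ρ = χ (seg (ρ 1)) * (χ (seg (ρ 0)))⁻¹ := by
  let H : C(I × I, I) := ⟨fun p => p.1 * ρ p.2, by fun_prop⟩
  have h := χ.map_square H
  rw [show H.comp (vside true) = ρ by ext; simp [H, vside],
    show H.comp (vside false) = ContinuousMap.const I 0 by ext; simp [H, vside],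
    show H.comp (hside true) = seg (ρ 1) by ext; simp [H, hside, seg],
    show H.comp (hside false) = seg (ρ 0) by ext; simp [H, hside, seg], map_const, mul_one] at h
  exact eq_mul_inv_of_mul_eq h

end PathCocycle

namespace ArcAttach

open PathCocycle

variable {J Y : Type*} [TopologicalSpace Y] {s t : J → Y} {Z : Type*} {G : Type*} [Group G]

/-- The function on a space with arcs attached that is `f` on the space and `p j` on the `j`-th
arc. -/
def desc (f : Y → Z) (p : J → I → Z) (h0 : ∀ j, p j 0 = f (s j)) (h1 : ∀ j, p j 1 = f (t j)) :
    ArcAttach s t → Z :=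
  Quot.lift (Sum.elim f fun e => p e.1 e.2) (by
    rintro _ _ (j | j)
    · exact h0 j
    · exact h1 j)

theorem cases {P : ArcAttach s t → Prop} (h : ∀ y, P (incl s t y)) (h' : ∀ j r, P (arc s t j r)) :
    ∀ p, P p := by
  rintro ⟨y | ⟨j, r⟩⟩
  · exact h y
  · exact h' j r

theorem isOpen_iff {S : Set (ArcAttach s t)} :
    IsOpen S ↔ IsOpen (incl s t ⁻¹' S) ∧ ∀ j, IsOpen (arc s t j ⁻¹' S) := by
  refine ⟨fun h => ⟨h.preimage (incl s t).continuous, fun j => h.preimage (arc s t j).continuous⟩,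
    fun h => ?_⟩
  change IsOpen (Quot.mk _ ⁻¹' S)
  rw [isOpen_sum_iff]
  exact ⟨h.1, isOpen_sigma_iff.2 h.2⟩

variable (s t) in
/-- The function `r ↦ r * (1 - r)` on each arc, and zero on the given space. -/
def depth : C(ArcAttach s t, ℝ) :=
  lift (ContinuousMap.const Y 0) fun _ =>
    { toFun := fun r => r * (1 - r)
      continuous_toFun := by fun_prop
      source' := by simp
      target' := by simp }

@[simp] theorem depth_incl (y : Y) : depth s t (incl s t y) = 0 := rfl

@[simp] theorem depth_arc (j : J) (r : I) : depth s t (arc s t j r) = r * (1 - r) := rfl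

variable (s t) in
/-- The given space together with the first third and the last third of each arc. -/
def outer : Set (ArcAttach s t) := {p | depth s t p < 2 / 9}

variable (s t) in
/-- The interiors of the arcs. -/
def inner : Set (ArcAttach s t) := {p | 0 < depth s t p}

theorem isOpen_outer : IsOpen (outer s t) := isOpen_lt (depth s t).continuous continuous_const

theorem isOpen_inner : IsOpen (inner s t) := isOpen_lt continuous_const (depth s t).continuous

theorem outer_union_inner : outer s t ∪ inner s t = Set.univ := by
  ext p
  simp only [outer, inner, Set.mem_union, Set.mem_ofPred_eq, Set.mem_univ, iff_true]
  by_contra! h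
  linarith [h.1, h.2]

/-- The threshold is explained by `r * (1 - r) - 2 / 9 = (r - 1 / 3) * (2 / 3 - r)`. -/
theorem arc_mem_outer {j : J} {r : I} :
    arc s t j r ∈ outer s t ↔ (r : ℝ) < 1 / 3 ∨ 2 / 3 < (r : ℝ) := by
  simp only [outer, Set.mem_ofPred_eq, depth_arc]
  constructor
  · intro h
    by_contra! h'
    nlinarith [mul_nonneg (sub_nonneg.2 h'.1) (sub_nonneg.2 h'.2)]
  · rintro (h | h)
    · nlinarith [mul_pos (sub_pos.2 h) (by linarith : (0 : ℝ) < 2 / 3 - r)]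
    · nlinarith [mul_pos (sub_pos.2 h) (by linarith : (0 : ℝ) < r - 1 / 3)]

theorem arc_mem_inner {j : J} {r : I} :
    arc s t j r ∈ inner s t ↔ 0 < (r : ℝ) ∧ (r : ℝ) < 1 := by
  simp only [inner, Set.mem_ofPred_eq, depth_arc]
  have h0 := r.2.1
  have h1 := r.2.2
  constructor
  · intro h
    constructor <;> by_contra! h' <;> nlinarith
  · rintro ⟨h, h'⟩
    exact mul_pos h (by linarith)

theorem incl_notMem_inner {y : Y} : incl s t y ∉ inner s t := by simp [inner]

variable (s t) in
/-- The map that contracts each half of an arc to its end point. -/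
def retract : ArcAttach s t → Y :=
  desc id (fun j r => if (r : ℝ) < 1 / 2 then s j else t j) (by simp)
    (fun j => if_neg (by norm_num))

@[simp] theorem retract_incl (y : Y) : retract s t (incl s t y) = y := rfl

theorem retract_arc (j : J) (r : I) :
    retract s t (arc s t j r) = if (r : ℝ) < 1 / 2 then s j else t j := rfl

/-- The jump at `1 / 2` is harmless because `outer` omits the middle third; this is what makes
`retract`, which may jump there, continuous on `outer`. -/
theorem isOpen_outer_arc_inter (j : J) {p q : Prop} :
    IsOpen {r : I | arc s t j r ∈ outer s t ∧ if (r : ℝ) < 1 / 2 then p else q} := by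
  have h : {r : I | arc s t j r ∈ outer s t ∧ if (r : ℝ) < 1 / 2 then p else q} =
      {r : I | (r : ℝ) < 1 / 3} ∩ {_r | p} ∪ {r : I | 2 / 3 < (r : ℝ)} ∩ {_r | q} := by
    ext r
    simp only [arc_mem_outer, Set.mem_ofPred_eq, Set.mem_union, Set.mem_inter_iff]
    split_ifs with hr
    · constructor
      · rintro ⟨h | h, hp⟩
        · exact Or.inl ⟨h, hp⟩
        · linarith
      · rintro (h | h)
        · exact ⟨Or.inl h.1, h.2⟩
        · linarith [h.1]
    · constructor
      · rintro ⟨h | h, hp⟩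
        · linarith
        · exact Or.inr ⟨h, hp⟩
      · rintro (h | h)
        · linarith [h.1]
        · exact ⟨Or.inr h.1, h.2⟩
  rw [h]
  exact ((isOpen_lt continuous_subtype_val continuous_const).inter isOpen_const).union
    ((isOpen_lt continuous_const continuous_subtype_val).inter isOpen_const)

theorem continuousOn_retract : ContinuousOn (retract s t) (outer s t) := by
  rw [continuousOn_open_iff isOpen_outer]
  intro W hW
  refine isOpen_iff.2 ⟨?_, fun j => ?_⟩
  · convert hW using 1
    ext y
    simp [outer]
  · convert isOpen_outer_arc_inter (s := s) (t := t) j (p := s j ∈ W) (q := t j ∈ W) using 1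
    ext r
    simp only [Set.mem_preimage, Set.mem_inter_iff, retract_arc, Set.mem_ofPred_eq]
    split_ifs <;> rfl

/-- A function that is constant on the interior of each half of an arc is constant along the paths
in the union of the first thirds and the last thirds of the interiors of the arcs. -/
theorem apply_eq_of_outer_inner (F : ArcAttach s t → Z) (A B : J → Z)
    (hF : ∀ j r, arc s t j r ∈ inner s t →
      F (arc s t j r) = if (r : ℝ) < 1 / 2 then A j else B j)
    (f : C(I, ArcAttach s t)) (h1 : ∀ x, f x ∈ outer s t) (h2 : ∀ x, f x ∈ inner s t) (x y : I) :
    F (f x) = F (f y) := by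
  have h : IsLocallyConstant (F ∘ f) := by
    intro S
    have hS : IsOpen (outer s t ∩ inner s t ∩ F ⁻¹' S) := by
      refine isOpen_iff.2 ⟨?_, fun j => ?_⟩
      · convert isOpen_empty
        ext y
        simp [incl_notMem_inner]
      · convert (isOpen_inner.preimage (arc s t j).continuous).inter
          (isOpen_outer_arc_inter (s := s) (t := t) j (p := A j ∈ S) (q := B j ∈ S)) using 1
        ext r
        simp only [Set.mem_preimage, Set.mem_inter_iff, Set.mem_ofPred_eq]
        by_cases hr : arc s t j r ∈ inner s t
        · simp only [hF j r hr, hr]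
          split_ifs <;> tauto
        · simp [hr]
    convert hS.preimage f.continuous using 1
    ext x
    simp [h1, h2]
  exact h.apply_eq_of_isPreconnected isPreconnected_univ trivial trivial

/-- A path in the interiors of the arcs runs in one arc. -/
theorem exists_eq_arc_comp (f : C(I, ArcAttach s t)) (h : ∀ x, f x ∈ inner s t) :
    ∃ (j : J) (ρ : C(I, I)), f = (arc s t j : C(I, ArcAttach s t)).comp ρ := by
  classical
  -- `F` records the arc and `c` the position on it. Their values at the ends of arcs only serve to
  -- make them well defined on the quotient.
  let F : ArcAttach s t → Option J := desc (fun _ => none)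
    (fun j r => if r = 0 ∨ r = 1 then none else some j) (by simp) (by simp)
  let c : ArcAttach s t → I := desc (fun _ => 0) (fun j r => if r = 1 then 0 else r)
    (by simp) (by simp)
  have hF : ∀ {j r}, arc s t j r ∈ inner s t → F (arc s t j r) = some j := by
    intro j r hr
    rw [arc_mem_inner] at hr
    refine if_neg ?_
    rintro (rfl | rfl)
    · exact lt_irrefl _ hr.1
    · exact lt_irrefl _ hr.2
  have hc : ∀ {j r}, arc s t j r ∈ inner s t → c (arc s t j r) = r := by
    intro j r hr
    rw [arc_mem_inner] at hr
    refine if_neg ?_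
    rintro rfl
    exact lt_irrefl _ hr.2
  have hFf : IsLocallyConstant (F ∘ f) := by
    intro S
    have hS : IsOpen (inner s t ∩ F ⁻¹' S) := by
      refine isOpen_iff.2 ⟨?_, fun j => ?_⟩
      · convert isOpen_empty
        ext y
        simp [incl_notMem_inner]
      · convert (isOpen_inner.preimage (arc s t j).continuous).inter
          (isOpen_const (p := some j ∈ S)) using 1
        ext r
        by_cases hr : arc s t j r ∈ inner s t
        · simp [hF hr, hr]
        · simp [hr]
    convert hS.preimage f.continuous using 1
    ext x
    simp [h]
  have hcf : Continuous (c ∘ f) := by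
    have : ContinuousOn c (inner s t) := by
      rw [continuousOn_open_iff isOpen_inner]
      intro W hW
      refine isOpen_iff.2 ⟨?_, fun j => ?_⟩
      · convert isOpen_empty
        ext y
        simp [incl_notMem_inner]
      · convert (isOpen_inner.preimage (arc s t j).continuous).inter hW using 1
        ext r
        by_cases hr : arc s t j r ∈ inner s t
        · simp [hc hr, hr]
        · simp [hr]
    exact this.comp_continuous f.continuous h
  have hp : ∀ p ∈ inner s t, ∃ j, F p = some j ∧ p = arc s t j (c p) := by
    refine cases (fun y hy => (incl_notMem_inner hy).elim) fun j r hr => ⟨j, hF hr, ?_⟩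
    rw [hc hr]
  obtain ⟨j, hj, -⟩ := hp _ (h 0)
  refine ⟨j, ⟨_, hcf⟩, ContinuousMap.ext fun x => ?_⟩
  obtain ⟨j', hj', hx⟩ := hp _ (h x)
  have : some j' = some j := by
    rw [← hj, ← hj']
    exact hFf.apply_eq_of_isPreconnected isPreconnected_univ trivial trivial
  obtain rfl := Option.some_injective _ this
  exact hx

/-- A cocycle extends to the space with arcs attached, with arbitrary values on the arcs. -/
theorem exists_cocycle (φ : PathCocycle Y G) (g : J → G) :
    ∃ Φ : PathCocycle (ArcAttach s t) G, (∀ f, Φ ((incl s t).comp f) = φ f) ∧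
      ∀ j, Φ (arc s t j) = g j := by
  classical
  -- On `inner` the cocycle is the coboundary of a step function jumping from `1` to `g j` in the
  -- middle of the arc; on `outer` it is pulled back from `Y` along the retraction. On paths in the
  -- overlap both are trivial.
  let h : ArcAttach s t → G := desc (fun _ => 1)
    (fun j r => if r = 1 then 1 else if (r : ℝ) < 1 / 2 then 1 else g j) (by simp) (by simp)
  have harc : ∀ {j r}, arc s t j r ∈ inner s t →
      h (arc s t j r) = if (r : ℝ) < 1 / 2 then 1 else g j := by
    intro j r hr
    rw [arc_mem_inner] at hr
    refine if_neg ?_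
    rintro rfl
    exact lt_irrefl _ hr.2
  let ret : C(↥(outer s t), Y) := ⟨_, continuousOn_iff_continuous_domRestrict.1 continuousOn_retract⟩
  obtain ⟨Φ, hΦ, hΦ'⟩ := exists_glue isOpen_outer isOpen_inner outer_union_inner (φ.comap ret)
    (coboundary fun p => h p) (by
      intro f h1 h2
      rw [comap_apply, coboundary_apply,
        show ret.comp (restrictRange f h1) = ContinuousMap.const I (retract s t (f 0)) from
          ContinuousMap.ext fun x => apply_eq_of_outer_inner _ s t (fun j r _ => rfl) f h1 h2 x 0,
        PathCocycle.map_const]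
      change _ = h (f 1) * (h (f 0))⁻¹
      rw [apply_eq_of_outer_inner h (fun _ => 1) g (fun j r hr => harc hr) f h1 h2 1 0,
        mul_inv_cancel])
  have hout : ∀ (f : C(I, ArcAttach s t)) (y : Y), (∀ x, f x ∈ outer s t) →
      (∀ x, retract s t (f x) = y) → Φ f = 1 := by
    intro f y h1 h2
    have := hΦ (restrictRange f h1)
    rwa [comap_apply, show ret.comp (restrictRange f h1) = ContinuousMap.const I y from
      ContinuousMap.ext h2, PathCocycle.map_const] at this
  have hinn : ∀ (f : C(I, ArcAttach s t)), (∀ x, f x ∈ inner s t) →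
      Φ f = h (f 1) * (h (f 0))⁻¹ := fun f h1 => hΦ' (restrictRange f h1)
  refine ⟨Φ, fun f => ?_, fun j => ?_⟩
  · have hf : ∀ x, incl s t (f x) ∈ outer s t := fun x => by simp [outer]
    exact hΦ (restrictRange ((incl s t).comp f) hf)
  · have e0 : ∀ x, ((half false x : I) : ℝ) = x / 2 := coe_half_false
    have e1 : ∀ x, ((half true x : I) : ℝ) = (x + 1) / 2 := coe_half_true
    have hx : ∀ x : I, 0 ≤ (x : ℝ) ∧ (x : ℝ) ≤ 1 := fun x => x.2
    -- The arc is cut in quarters. The extreme ones retract to a point, and the jump occurs on the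
    -- second, since the step function already equals `g j` at `1 / 2`.
    rw [map_halves, Φ.map_halves (ContinuousMap.comp _ (half false)),
      Φ.map_halves (ContinuousMap.comp _ (half true)),
      hout ((ContinuousMap.comp _ (half true)).comp (half true)) (t j),
      hout ((ContinuousMap.comp _ (half false)).comp (half false)) (s j),
      hinn ((ContinuousMap.comp _ (half true)).comp (half false)),
      hinn ((ContinuousMap.comp _ (half false)).comp (half true))]
    · simp only [ContinuousMap.comp_apply, ContinuousMap.coe_coe]
      rw [harc, harc, harc, harc]
      · simp only [e0, e1]
        norm_num
      all_goals
        rw [arc_mem_inner]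
        simp only [e0, e1]
        norm_num
    · intro x
      obtain ⟨h0, h1⟩ := hx x
      simp only [ContinuousMap.comp_apply, ContinuousMap.coe_coe, arc_mem_inner, e0, e1]
      constructor <;> linarith
    · intro x
      obtain ⟨h0, h1⟩ := hx x
      simp only [ContinuousMap.comp_apply, ContinuousMap.coe_coe, arc_mem_inner, e0, e1]
      constructor <;> linarith
    · intro x
      obtain ⟨h0, h1⟩ := hx x
      simp only [ContinuousMap.comp_apply, ContinuousMap.coe_coe, arc_mem_outer, e0]
      left
      linarith
    · intro x
      obtain ⟨h0, h1⟩ := hx x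
      simp only [ContinuousMap.comp_apply, ContinuousMap.coe_coe, retract_arc, e0]
      exact if_pos (by linarith)
    · intro x
      obtain ⟨h0, h1⟩ := hx x
      simp only [ContinuousMap.comp_apply, ContinuousMap.coe_coe, arc_mem_outer, e1]
      right
      linarith
    · intro x
      obtain ⟨h0, h1⟩ := hx x
      simp only [ContinuousMap.comp_apply, ContinuousMap.coe_coe, retract_arc, e1]
      exact if_neg (by linarith)

/-! ### Deformation along the arcs and uniqueness of cocycles. -/

/-- A homotopy of the unit interval relative to its end points that moves the first third to `0`
and the last third to `1`. -/
def slide : C(I × I, I) :=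
  ⟨fun p => Set.projIcc 0 1 zero_le_one ((1 - p.2) * p.1 + p.2 * (3 * p.1 - 1) : ℝ), by fun_prop⟩

theorem slide_apply (r x : I) :
    slide (r, x) = Set.projIcc 0 1 zero_le_one ((1 - x) * r + x * (3 * r - 1) : ℝ) := rfl

theorem slide_left (x : I) : slide (0, x) = 0 := by
  rw [slide_apply, Set.projIcc_of_le_left]
  · rfl
  · have := x.2.1
    simp [this]

theorem slide_right (x : I) : slide (1, x) = 1 := by
  rw [slide_apply, Set.projIcc_of_right_le]
  · rfl
  · have := x.2.1
    simp only [Set.Icc.coe_one]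
    linarith

theorem slide_zero (r : I) : slide (r, 0) = r := by
  rw [slide_apply]
  simp

theorem slide_one_of_lt {r : I} (hr : (r : ℝ) < 1 / 3) : slide (r, 1) = 0 := by
  rw [slide_apply, Set.projIcc_of_le_left]
  · rfl
  · simp only [Set.Icc.coe_one]
    linarith

theorem slide_one_of_gt {r : I} (hr : 2 / 3 < (r : ℝ)) : slide (r, 1) = 1 := by
  rw [slide_apply, Set.projIcc_of_right_le]
  · rfl
  · simp only [Set.Icc.coe_one]
    linarith

variable (s t) in
/-- The deformation of a space with arcs attached given by `slide` on each arc. -/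
def deform : C(ArcAttach s t, C(I, ArcAttach s t)) :=
  -- Taking values in a path space lets `lift` build the homotopy, with no product of a quotient
  -- space and `I` to examine.
  lift (ContinuousMap.curry ((incl s t).comp ContinuousMap.fst)) fun j =>
    { toContinuousMap := ContinuousMap.curry ((arc s t j : C(I, ArcAttach s t)).comp slide)
      source' := by
        ext x
        change arc s t j (slide (0, x)) = incl s t (s j)
        rw [slide_left, (arc s t j).source]
      target' := by
        ext x
        change arc s t j (slide (1, x)) = incl s t (t j)
        rw [slide_right, (arc s t j).target] }

theorem deform_incl (y : Y) : deform s t (incl s t y) = ContinuousMap.const I (incl s t y) := rfl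

theorem deform_zero : ∀ p, deform s t p 0 = p := by
  refine cases (fun y => rfl) fun j r => ?_
  change arc s t j (slide (r, 0)) = _
  rw [slide_zero]

theorem deform_one : ∀ p ∈ outer s t, deform s t p 1 = incl s t (retract s t p) := by
  refine cases (fun y _ => rfl) fun j r hr => ?_
  change arc s t j (slide (r, 1)) = _
  rw [retract_arc]
  rcases arc_mem_outer.1 hr with h | h
  · rw [slide_one_of_lt h, if_pos (by linarith), (arc s t j).source]
  · rw [slide_one_of_gt h, if_neg (by linarith), (arc s t j).target]

/-- On paths with end points in the given space, a cocycle is determined by its values on the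
paths of the given space and on the attached arcs. -/
theorem cocycle_eq {Φ Ψ : PathCocycle (ArcAttach s t) G}
    (hY : ∀ f : C(I, Y), Φ ((incl s t).comp f) = Ψ ((incl s t).comp f))
    (harc : ∀ j, Φ (arc s t j) = Ψ (arc s t j)) {y y' : Y}
    (γ : Path (incl s t y) (incl s t y')) : Φ γ = Ψ γ := by
  let a : J → C(I, ArcAttach s t) := fun j => arc s t j
  -- `k` is a gauge transformation from `Φ` to `Ψ`, equal to `1` on `Y` and found on an arc by
  -- comparing initial segments; `harc` makes it consistent at the far end.
  let k : ArcAttach s t → G := desc (fun _ => 1)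
    (fun j r => Ψ ((a j).comp (seg r)) * (Φ ((a j).comp (seg r)))⁻¹)
    (fun j => by simp)
    (fun j => by
      rw [seg_one, ContinuousMap.comp_id]
      change Ψ (arc s t j) * (Φ (arc s t j))⁻¹ = 1
      rw [harc, mul_inv_cancel])
  have hk : ∀ y, k (incl s t y) = 1 := fun _ => rfl
  have hkarc : ∀ j (ρ : C(I, I)), k (arc s t j (ρ 1)) * Φ ((a j).comp ρ) =
      Ψ ((a j).comp ρ) * k (arc s t j (ρ 0)) := by
    intro j ρ
    have h1 := map_interval (Φ.comap (a j)) ρ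
    have h2 := map_interval (Ψ.comap (a j)) ρ
    simp only [comap_apply] at h1 h2
    rw [h1, h2]
    change Ψ ((a j).comp (seg (ρ 1))) * (Φ ((a j).comp (seg (ρ 1))))⁻¹ * _ =
      _ * (Ψ ((a j).comp (seg (ρ 0))) * (Φ ((a j).comp (seg (ρ 0))))⁻¹)
    group
  have hdeform : ∀ p ∈ outer s t, Φ (deform s t p) = Ψ (deform s t p) * k p := by
    intro p hp
    have h : ∀ p, k (deform s t p 1) * Φ (deform s t p) =
        Ψ (deform s t p) * k (deform s t p 0) := by
      refine cases (fun y => ?_) fun j r => ?_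
      · simp [deform_incl, hk]
      · exact hkarc j (slide.curry r)
    simpa only [deform_zero, deform_one p hp, hk, one_mul] using h p
  have key : ∀ f : C(I, ArcAttach s t), k (f 1) * Φ f = Ψ f * k (f 0) := by
    refine path_induction (O := fun b : Bool => bif b then outer s t else inner s t) ?_ ?_ ?_ ?_
    · rintro (_ | _)
      · exact isOpen_inner
      · exact isOpen_outer
    · intro p
      rcases (outer_union_inner (s := s) (t := t) ▸ Set.mem_univ p : p ∈ outer s t ∪ inner s t)
        with hp | hp
      · exact ⟨true, hp⟩
      · exact ⟨false, hp⟩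
    · rintro (_ | _) f hf
      · obtain ⟨j, ρ, rfl⟩ := exists_eq_arc_comp f hf
        exact hkarc j ρ
      · replace hf : ∀ x, f x ∈ outer s t := hf
        let f' : C(I, Y) := ⟨retract s t ∘ f, continuousOn_retract.comp_continuous f.continuous hf⟩
        -- The deformation sweeps out a square between `f` and its retraction `f'` in `Y`, where `Φ`
        -- and `Ψ` agree; its other sides are the tracks treated in `hdeform`.
        have hsq : ∀ χ : PathCocycle (ArcAttach s t) G,
            χ ((incl s t).comp f') * χ (deform s t (f 0)) = χ (deform s t (f 1)) * χ f := by
          intro χ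
          let H : C(I × I, ArcAttach s t) :=
            ((deform s t).comp f).uncurry.comp (ContinuousMap.prodSwap : C(I × I, I × I))
          have h := χ.map_square H
          rwa [show H.comp (vside true) = (incl s t).comp f' from
              ContinuousMap.ext fun x => deform_one _ (hf x),
            show H.comp (vside false) = f from ContinuousMap.ext fun x => deform_zero _,
            show H.comp (hside true) = deform s t (f 1) from rfl,
            show H.comp (hside false) = deform s t (f 0) from rfl] at h
        have h1 := hsq Φ
        have h2 := hsq Ψ
        rw [hY, hdeform _ (hf 0), hdeform _ (hf 1), ← mul_assoc, h2, mul_assoc, mul_assoc] at h1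
        exact (mul_left_cancel h1).symm
    · intro f h0 h1
      simp only [ContinuousMap.comp_apply, half_false_zero, half_true_one, half_true_zero] at h0 h1
      rw [map_halves, Ψ.map_halves, ← mul_assoc, h1, mul_assoc, h0, mul_assoc]
  have h := key γ
  simpa only [ContinuousMap.coe_coe, γ.source, γ.target, hk, one_mul, mul_one] using h

theorem joined_arc (j : J) (r : I) : Joined (incl s t (s j)) (arc s t j r) :=
  ⟨⟨(arc s t j : C(I, ArcAttach s t)).comp (seg r), by
    simp [seg_apply], by simp [seg_apply]⟩⟩

theorem joined_of_joined {y₀ : Y} (h : ∀ y, Joined (incl s t y₀) (incl s t y)) :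
    ∀ p, Joined (incl s t y₀) p :=
  cases h fun j r => (h _).trans (joined_arc j r)

end ArcAttach

/-! ### The fundamental group of a space with arcs attached -/

namespace PathCocycle

variable {X Y : Type*} [TopologicalSpace X] [TopologicalSpace Y]

/-- Classes of paths prescribed at some points extend to a choice of classes at all points. -/
theorem exists_tree {ι : Type*} {y₀ : Y} (hY : ∀ p, Joined y₀ p) {y : ι → Y}
    (hy : Function.Injective y) (q : ∀ i, Path.Homotopic.Quotient y₀ (y i)) :
    ∃ c : ∀ p, Path.Homotopic.Quotient y₀ p, ∀ i, c (y i) = q i := by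
  have h : ∀ p, ∃ c : Path.Homotopic.Quotient y₀ p, ∀ i (h : y i = p), c = h ▸ q i := by
    intro p
    by_cases hp : ∃ i, y i = p
    · obtain ⟨i, rfl⟩ := hp
      refine ⟨q i, fun j hj => ?_⟩
      obtain rfl := hy hj
      rfl
    · exact ⟨.mk (hY p).somePath, fun i hi => (hp ⟨i, hi⟩).elim⟩
  choose c hc using h
  exact ⟨c, fun i => hc _ i rfl⟩

theorem tree_eq_one {x₀ p : X} {c : ∀ p, Path.Homotopic.Quotient x₀ p} (γ : Path x₀ p)
    (h₀ : c x₀ = .refl x₀) (hp : c p = .mk γ) : tree c γ = 1 := by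
  rw [tree_apply, h₀, hp, Path.Homotopic.Quotient.trans_symm, Path.Homotopic.Quotient.refl_trans]
  rfl

theorem hom_ext {M : Type*} [Monoid M] {p : X} {f g : FundamentalGroup X p →* M}
    (h : ∀ γ : Path p p, f (loop γ) = g (loop γ)) : f = g :=
  MonoidHom.ext fun a => Quotient.inductionOn a h

end PathCocycle

theorem ArcAttach.incl_injective {J Y : Type*} [TopologicalSpace Y] (s t : J → Y) :
    Function.Injective (ArcAttach.incl s t) :=
  Function.LeftInverse.injective (g := ArcAttach.retract s t) ArcAttach.retract_incl

/-! ### The isomorphism `theta`. -/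

namespace SplitCover

open PathCocycle

variable {X : Type*} [TopologicalSpace X] {U V : Set X} {n : ℕ} {x : Fin (n + 1) → ↥(U ∩ V)}

theorem toU_injective (U V : Set X) : Function.Injective (toU U V) :=
  Set.inclusion_injective Set.inter_subset_left

theorem toV_injective (U V : Set X) : Function.Injective (toV U V) :=
  Set.inclusion_injective Set.inter_subset_right

theorem joined_of_isPathConnected {S : Set X} (hS : IsPathConnected S) (p q : ↥S) : Joined p q :=
  have := isPathConnected_iff_pathConnectedSpace.1 hS
  PathConnectedSpace.joined p q

theorem joined_base_UE (hUc : IsPathConnected U) : ∀ p, Joined (UE.base x) p :=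
  ArcAttach.joined_of_joined fun y =>
    (joined_of_isPathConnected hUc _ y).map (ArcAttach.incl _ _).continuous

theorem joined_base_GraphB : ∀ p, Joined (GraphB.base n) p :=
  ArcAttach.joined_of_joined fun i => by
    refine Fin.cases ?_ (fun j => ?_) i
    · rfl
    · exact ⟨ArcAttach.arc _ _ (Sum.inl j)⟩

theorem theta_inl (a : ∀ j : Fin n, Path (toU U V (x 0)) (toU U V (x j.succ)))
    (u : FundamentalGroup ↥U (toU U V (x 0))) :
    theta x a (Monoid.Coprod.inl u) = FundamentalGroup.map (ArcAttach.incl _ _) _ u := rfl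

theorem theta_inr (a : ∀ j : Fin n, Path (toU U V (x 0)) (toU U V (x j.succ)))
    (u : FundamentalGroup (GraphB n) (GraphB.base n)) :
    theta x a (Monoid.Coprod.inr u) = FundamentalGroup.map (inclBU x a) _ u := rfl

/-- The inverse comes from a cocycle `R` on `U^E`. Path classes to the points `x j.succ` are chosen
along the `a j` both in `U` and in the graph, so the edges `a` have trivial value on both sides, and
`R` is free to take the value of the matching graph edge on each attached arc. -/
theorem theta_bijective (hUc : IsPathConnected U) (hinj : Function.Injective x)
    (a : ∀ j : Fin n, Path (toU U V (x 0)) (toU U V (x j.succ))) :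
    Function.Bijective (theta x a) := by
  let s : Fin n → ↥U := fun _ => toU U V (x 0)
  let t : Fin n → ↥U := fun j => toU U V (x j.succ)
  let sB : Fin n ⊕ Fin n → Fin (n + 1) := fun _ => 0
  let tB : Fin n ⊕ Fin n → Fin (n + 1) := Sum.elim Fin.succ Fin.succ
  obtain ⟨cB, hcB⟩ := exists_tree (ι := Fin (n + 1)) (joined_base_GraphB (n := n))
    (ArcAttach.incl_injective sB tB)
    (Fin.cases (.refl _) fun j => .mk (ArcAttach.arc sB tB (Sum.inl j)))
  have hcB0 : cB (GraphB.base n) = .refl _ := hcB 0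
  have hcBj : ∀ j : Fin n, cB (ArcAttach.incl sB tB j.succ) =
      .mk (ArcAttach.arc sB tB (Sum.inl j)) := fun j => hcB j.succ
  obtain ⟨cU, hcU⟩ := exists_tree (ι := Fin (n + 1))
    (joined_of_isPathConnected hUc (toU U V (x 0)))
    (y := fun i => toU U V (x i)) ((toU_injective U V).comp hinj)
    (Fin.cases (.refl _) fun j => .mk (a j))
  have hcU0 : cU (toU U V (x 0)) = .refl _ := hcU 0
  have hcUj : ∀ j : Fin n, cU (toU U V (x j.succ)) = .mk (a j) := fun j => hcU j.succ
  obtain ⟨cE, hcE⟩ := exists_tree (ι := ↥U) (joined_base_UE (x := x) hUc)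
    (ArcAttach.incl_injective s t) (fun p => (cU p).map (ArcAttach.incl s t))
  have hcE0 : cE (UE.base x) = .refl _ := (hcE _).trans
    (congrArg (fun q => Path.Homotopic.Quotient.map q (ArcAttach.incl s t)) hcU0)
  obtain ⟨R, hRU, hRarc⟩ := ArcAttach.exists_cocycle (s := s) (t := t)
    ((tree cU).push (Monoid.Coprod.inl : _ →* Monoid.Coprod (FundamentalGroup ↥U (toU U V (x 0)))
        (FundamentalGroup (GraphB n) (GraphB.base n))))
    (fun j => Monoid.Coprod.inr (tree cB (ArcAttach.arc sB tB (Sum.inr j))))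
  have h1 : (R.hom (UE.base x)).comp (theta x a) = MonoidHom.id _ := by
    refine Monoid.Coprod.hom_ext (hom_ext fun γ => ?_) (hom_ext fun γ => ?_)
    · change R ((ArcAttach.incl s t).comp γ) = Monoid.Coprod.inl (loop γ)
      rw [hRU, push_apply, tree_loop hcU0]
    · change R.comap (inclBU x a) γ = (Monoid.Coprod.inr (loop γ) : Monoid.Coprod _ _)
      rw [← tree_loop hcB0 γ, ← push_apply]
      refine ArcAttach.cocycle_eq (fun f => ?_) ?_ γ
      -- The vertex set is discrete, so paths in it are constant.
      · have hf : f = ContinuousMap.const I (f 0) := ContinuousMap.ext fun r =>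
          (IsLocallyConstant.of_discrete (id : Fin (n + 1) → _)).comp_continuous f.continuous
            |>.apply_eq_of_isPreconnected isPreconnected_univ trivial trivial
        rw [hf]
        simp only [ContinuousMap.comp_const, PathCocycle.map_const]
      · rintro (j | j)
        · change R ((ArcAttach.incl s t).comp (a j)) = _
          rw [hRU, push_apply, push_apply, tree_eq_one (a j) hcU0 (hcUj j), map_one]
          exact ((congrArg Monoid.Coprod.inr
            (tree_eq_one (ArcAttach.arc sB tB (Sum.inl j)) hcB0 (hcBj j))).trans (map_one _)).symm
        · exact hRarc j
  have h2 : (theta x a).comp (R.hom (UE.base x)) = MonoidHom.id _ := by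
    refine hom_ext fun γ => ?_
    change R.push (theta x a) γ = loop γ
    rw [← tree_loop hcE0 γ]
    refine ArcAttach.cocycle_eq (fun f => ?_) (fun j => ?_) γ
    · rw [push_apply, hRU, push_apply, theta_inl]
      exact (tree_map (ArcAttach.incl s t) (asPath f) (hcE _) (hcE _)).symm
    · rw [push_apply, hRarc, theta_inr]
      refine (tree_map (inclBU x a) (ArcAttach.arc sB tB (Sum.inr j)) ?_ ?_).symm
      · exact hcE0.trans (congrArg (fun q => Path.Homotopic.Quotient.map q (inclBU x a)) hcB0).symm
      · refine Eq.trans ?_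
          (congrArg (fun q => Path.Homotopic.Quotient.map q (inclBU x a)) (hcBj j)).symm
        exact (hcE _).trans
          (congrArg (fun q => Path.Homotopic.Quotient.map q (ArcAttach.incl s t)) (hcUj j))
  exact Function.bijective_iff_has_inverse.2
    ⟨R.hom (UE.base x), DFunLike.congr_fun h1, DFunLike.congr_fun h2⟩

end SplitCover

/-! ### The presentation of the fundamental group of `X`. -/

namespace SplitCover

open PathCocycle

variable {X : Type*} [TopologicalSpace X] {U V : Set X} {n : ℕ} {x : Fin (n + 1) → ↥(U ∩ V)}

theorem injective_of_existsUnique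
    (hx : ∀ y : ↥(U ∩ V), ∃! i : Fin (n + 1), y ∈ pathComponent (x i)) : Function.Injective x :=
  fun i _ h => (hx (x i)).unique (mem_pathComponent_self _) (h ▸ mem_pathComponent_self _)

/-- The inclusion of the path component of `x i`, together with `x 0`, in `C_i^E`. -/
abbrev inclC (x : Fin (n + 1) → ↥(U ∩ V)) (i : Fin (n + 1)) : C(↥(CBase x i), CE x i) :=
  ArcAttach.incl (fun _ : {j : Fin n // j.succ = i} => CBase.source x i)
    (fun _ => CBase.target x i)

/-- A path in the path component of `x i`, together with `x 0`. -/
def liftC {i : Fin (n + 1)} (f : C(I, ↥(U ∩ V))) (hf : ∀ r, f r ∈ pathComponent (x i)) :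
    C(I, ↥(CBase x i)) := ⟨fun r => ⟨f r, Or.inl (hf r)⟩, by fun_prop⟩

theorem joined_target (i : Fin (n + 1)) :
    Joined (CE.base x i) (inclC x i (CBase.target x i)) := by
  revert i
  refine Fin.cases ?_ fun j => ?_
  · exact Joined.refl _
  · exact ⟨ArcAttach.arc _ _ ⟨j, rfl⟩⟩

theorem joined_base_CE (i : Fin (n + 1)) : ∀ p, Joined (CE.base x i) p := by
  refine ArcAttach.joined_of_joined ?_
  rintro ⟨y, hy | hy⟩
  · refine (joined_target i).trans ?_
    have hf : ∀ r, hy.somePath r ∈ pathComponent (x i) := fun r =>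
      ⟨hy.somePath.truncateOfLE r.2.1 |>.cast (by simp) (by simp)⟩
    exact ⟨⟨(inclC x i).comp (liftC (hy.somePath : C(I, ↥(U ∩ V))) hf),
      congrArg (inclC x i) (Subtype.ext hy.somePath.source),
      congrArg (inclC x i) (Subtype.ext hy.somePath.target)⟩⟩
  · obtain rfl : y = x 0 := hy
    rfl

theorem fromC_of (i : Fin (n + 1)) (g : FundamentalGroup (CE x i) (CE.base x i)) :
    fromC x (Monoid.CoprodI.of g) = FundamentalGroup.map (inclCE x i) (CE.base x i) g :=
  Monoid.CoprodI.lift_of _ _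

/-- The classes of paths in `U^E ∩ V` from the base point can be chosen such that the paths of
`U ∩ V` and the attached arcs are closed up to loops coming from the spaces `C_i^E`. -/
theorem exists_tree_WE (hx : ∀ y : ↥(U ∩ V), ∃! i : Fin (n + 1), y ∈ pathComponent (x i)) :
    ∃ D : ∀ p : WE x, Path.Homotopic.Quotient (WE.base x) p, D (WE.base x) = .refl _ ∧
      (∀ f : C(I, ↥(U ∩ V)), tree D ((ArcAttach.incl _ _).comp f) ∈ (fromC x).range) ∧
      ∀ j, tree D (ArcAttach.arc (fun _ : Fin n => x 0) (fun j => x j.succ) j) ∈ (fromC x).range := by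
  have hc : ∀ i, ∃ c : ∀ p : CE x i, Path.Homotopic.Quotient (CE.base x i) p,
      c (CE.base x i) = .refl _ := fun i =>
    (exists_tree (ι := Unit) (joined_base_CE (x := x) i) (y := fun _ => CE.base x i)
      (fun _ _ _ => rfl) (fun _ => .refl _)).imp fun c h => h ()
  choose c hc using hc
  choose k hk hk' using hx
  -- The class chosen for a point is the image of one in the `C_i^E` of its own component.
  let d : ∀ w : ↥(U ∩ V), Path.Homotopic.Quotient (WE.base x) (ArcAttach.incl _ _ w) := fun w =>
    (c (k w) (inclC x (k w) ⟨w, Or.inl (hk w)⟩)).map (inclCE x (k w))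
  have hd : ∀ i w (h : w ∈ pathComponent (x i)),
      d w = (c i (inclC x i ⟨w, Or.inl h⟩)).map (inclCE x i) := by
    intro i w h
    obtain rfl := hk' w i h
    rfl
  have hd0 : d (x 0) = .refl _ := (hd 0 (x 0) (mem_pathComponent_self _)).trans
    (congrArg (fun q => Path.Homotopic.Quotient.map q (inclCE x 0)) (hc 0))
  have hjoin : ∀ p, Joined (WE.base x) p := ArcAttach.joined_of_joined fun w => ⟨(d w).out⟩
  obtain ⟨D, hD⟩ := exists_tree (ι := ↥(U ∩ V)) hjoin (ArcAttach.incl_injective _ _) d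
  have hD0 : D (WE.base x) = .refl _ := (hD (x 0)).trans hd0
  have hD' : ∀ i w (h : w ∈ pathComponent (x i)),
      D (ArcAttach.incl _ _ w) = (c i (inclC x i ⟨w, Or.inl h⟩)).map (inclCE x i) :=
    fun i w h => (hD w).trans (hd i w h)
  refine ⟨D, hD0, fun f => ?_, fun j => ?_⟩
  · have hf : ∀ r, f r ∈ pathComponent (x (k (f 0))) := fun r =>
      (hk (f 0)).trans ⟨(asPath f).truncateOfLE r.2.1 |>.cast (by simp) (by simp; rfl)⟩
    refine ⟨Monoid.CoprodI.of (tree (c (k (f 0))) ((inclC x _).comp (liftC f hf))), ?_⟩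
    refine (fromC_of _ _).trans ?_
    exact (tree_map (inclCE x _) (asPath ((inclC x _).comp (liftC f hf)))
      (hD' _ _ (hf 0)) (hD' _ _ (hf 1))).symm
  · refine ⟨Monoid.CoprodI.of (i := j.succ) (tree (c j.succ) (ArcAttach.arc
      (fun _ : {k : Fin n // k.succ = j.succ} => CBase.source x j.succ)
      (fun _ => CBase.target x j.succ) ⟨j, rfl⟩)), ?_⟩
    refine (fromC_of _ _).trans ?_
    -- The arc starts at `x 0`, which lies in component `0` and not in component `j.succ`; the
    -- choices still match there because both are trivial at the base point.
    exact (tree_map (inclCE x _) (c := c j.succ) (d := D) (ArcAttach.arc _ _ ⟨j, rfl⟩)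
      (hD0.trans (congrArg (fun q => Path.Homotopic.Quotient.map q (inclCE x j.succ))
        (hc j.succ)).symm)
      (hD' j.succ (x j.succ) (mem_pathComponent_self _))).symm

/-- The map from `U^E` to `X` that runs along the path `b j` of `V` on the `j`-th arc. -/
def mapUE (b : ∀ j : Fin n, Path (toV U V (x 0)) (toV U V (x j.succ))) : C(UE x, X) :=
  ArcAttach.lift (inclusion U) fun j => (b j).map (inclusion V).continuous

theorem mapUE_comp_inclWU (b : ∀ j : Fin n, Path (toV U V (x 0)) (toV U V (x j.succ))) :
    (mapUE b).comp (inclWU x) = (inclusion V).comp (inclWV x b) :=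
  ContinuousMap.ext (ArcAttach.cases (fun _ => rfl) fun _ _ => rfl)

/-- This is why the relators die in the fundamental group of `X`: the two routes from `U^E ∩ V` to
`X` are the same map. -/
theorem map_mapUE_i1E (b : ∀ j : Fin n, Path (toV U V (x 0)) (toV U V (x j.succ)))
    (h : FundamentalGroup (WE x) (WE.base x)) :
    FundamentalGroup.map (mapUE b) (UE.base x) (i1E x h) =
      FundamentalGroup.map (inclusion V) (toV U V (x 0)) (i2E x b h) := by
  induction h using Quotient.inductionOn with | h γ
  refine congrArg loop (Path.ext (funext fun r => ?_))
  exact DFunLike.congr_fun (mapUE_comp_inclWU b) (γ r)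

/-- The canonical homomorphism from the free product to the fundamental group of `X`. -/
def toX (x : Fin (n + 1) → ↥(U ∩ V)) (a : ∀ j : Fin n, Path (toU U V (x 0)) (toU U V (x j.succ)))
    (b : ∀ j : Fin n, Path (toV U V (x 0)) (toV U V (x j.succ))) :
    FreeProd x →* FundamentalGroup X (x 0 : X) :=
  Monoid.Coprod.lift
    (Monoid.Coprod.lift (FundamentalGroup.map (inclusion U) (toU U V (x 0)))
      (FundamentalGroup.map (inclusion V) (toV U V (x 0))))
    ((FundamentalGroup.map (mapUE b) (UE.base x)).comp
      (FundamentalGroup.map (inclBU x a) (GraphB.base n)))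

theorem toX_embUB (a : ∀ j : Fin n, Path (toU U V (x 0)) (toU U V (x j.succ)))
    (b : ∀ j : Fin n, Path (toV U V (x 0)) (toV U V (x j.succ)))
    (w : Monoid.Coprod (FundamentalGroup ↥U (toU U V (x 0)))
      (FundamentalGroup (GraphB n) (GraphB.base n))) :
    toX x a b (embUB x w) = FundamentalGroup.map (mapUE b) (UE.base x) (theta x a w) := by
  have h : (toX x a b).comp (embUB x) =
      (FundamentalGroup.map (mapUE b) (UE.base x)).comp (theta x a) :=
    Monoid.Coprod.hom_ext (hom_ext fun γ => rfl) (hom_ext fun γ => rfl)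
  exact DFunLike.congr_fun h w

theorem toX_embV (a : ∀ j : Fin n, Path (toU U V (x 0)) (toU U V (x j.succ)))
    (b : ∀ j : Fin n, Path (toV U V (x 0)) (toV U V (x j.succ)))
    (v : FundamentalGroup ↥V (toV U V (x 0))) :
    toX x a b (embV x v) = FundamentalGroup.map (inclusion V) _ v := rfl

theorem normalClosure_relators_le_ker
    (a : ∀ j : Fin n, Path (toU U V (x 0)) (toU U V (x j.succ)))
    (b : ∀ j : Fin n, Path (toV U V (x 0)) (toV U V (x j.succ))) :
    Subgroup.normalClosure (relators x a b) ≤ (toX x a b).ker := by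
  refine Subgroup.normalClosure_le_normal ?_
  rintro _ ⟨g, w, hw, rfl⟩
  have h : toX x a b (embUB x w) * toX x a b ((embUB x w)⁻¹ * embV x (i2E x b (fromC x g))) =
      toX x a b (embUB x w) := by
    rw [← map_mul]
    refine (congrArg (toX x a b) (mul_inv_cancel_left _ _)).trans ?_
    rw [toX_embUB, hw, toX_embV, map_mapUE_i1E]
  exact mul_eq_left.1 h

/-- The inverse of the canonical map from the quotient is built by gluing. All choices of path
classes descend from `D` at the points of `U ∩ V`, so that `tree_map` compares the cocycles on
`U^E`, `V` and `X`. -/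
theorem nonempty_mulEquiv (hU : IsOpen U) (hV : IsOpen V) (hUV : U ∪ V = Set.univ)
    (hUc : IsPathConnected U) (hVc : IsPathConnected V)
    (hx : ∀ y : ↥(U ∩ V), ∃! i : Fin (n + 1), y ∈ pathComponent (x i))
    (a : ∀ j : Fin n, Path (toU U V (x 0)) (toU U V (x j.succ)))
    (b : ∀ j : Fin n, Path (toV U V (x 0)) (toV U V (x j.succ))) :
    Nonempty (FundamentalGroup X (x 0 : X) ≃*
      FreeProd x ⧸ Subgroup.normalClosure (relators x a b)) := by
  obtain ⟨D, hD0, hDf, hDarc⟩ := exists_tree_WE hx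
  let W : C(↥(U ∩ V), WE x) := ArcAttach.incl _ _
  let E : C(↥U, UE x) := ArcAttach.incl _ _
  have hE : Function.Injective E := ArcAttach.incl_injective _ _
  -- compatible choices of classes of paths in `U^E`, in `V` and in `X`
  obtain ⟨cE, hcE⟩ := exists_tree (ι := ↥(U ∩ V)) (joined_base_UE (x := x) hUc)
    (y := fun w => E (toU U V w)) (hE.comp (toU_injective U V))
    (fun w => (D (W w)).map (inclWU x))
  obtain ⟨cV, hcV⟩ := exists_tree (ι := ↥(U ∩ V))
    (joined_of_isPathConnected hVc (toV U V (x 0)))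
    (y := toV U V) (toV_injective U V) (fun w => (D (W w)).map (inclWV x b))
  have hcE0 : cE (UE.base x) = .refl _ := (hcE (x 0)).trans
    (congrArg (fun q => Path.Homotopic.Quotient.map q (inclWU x)) hD0)
  have hcV0 : cV (toV U V (x 0)) = .refl _ := (hcV (x 0)).trans
    (congrArg (fun q => Path.Homotopic.Quotient.map q (inclWV x b)) hD0)
  have hxX : ∃ c : ∀ p, Path.Homotopic.Quotient (x 0 : X) p,
      (∀ p, c (p : ↥U) = (cE (E p)).map (mapUE b)) ∧ ∀ p, c (p : ↥V) = (cV p).map (inclusion V) := by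
    -- Indexing by `U` and `V \ U` prescribes each point once; over `U ∩ V` the two prescriptions
    -- agree because both come from `D`.
    obtain ⟨c, hc⟩ := exists_tree (ι := ↥U ⊕ {v : ↥V // (v : X) ∉ U}) (y₀ := (x 0 : X))
      (y := Sum.elim Subtype.val fun v => v.1.1)
      (fun p => by
        rcases (hUV ▸ Set.mem_univ p : p ∈ U ∪ V) with hp | hp
        · exact (joined_of_isPathConnected hUc (toU U V (x 0)) ⟨p, hp⟩).map continuous_subtype_val
        · exact (joined_of_isPathConnected hVc (toV U V (x 0)) ⟨p, hp⟩).map continuous_subtype_val)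
      (by
        rintro (p | p) (q | q) h
        · exact congrArg Sum.inl (Subtype.ext h)
        · exact (q.2 ((show (p : X) = q.1.1 from h) ▸ p.2)).elim
        · exact (p.2 ((show p.1.1 = (q : X) from h) ▸ q.2)).elim
        · exact congrArg Sum.inr (Subtype.ext (Subtype.ext h)))
      (fun i => match i with
        | Sum.inl p => (cE (E p)).map (mapUE b)
        | Sum.inr v => (cV v.1).map (inclusion V))
    refine ⟨c, fun p => hc (Sum.inl p), fun p => ?_⟩
    by_cases hp : (p : X) ∈ U
    · let w : ↥(U ∩ V) := ⟨p, hp, p.2⟩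
      refine (hc (Sum.inl (toU U V w))).trans ?_
      refine (congrArg (fun q => Path.Homotopic.Quotient.map q (mapUE b)) (hcE w)).trans ?_
      refine Eq.trans ?_
        (congrArg (fun q => Path.Homotopic.Quotient.map q (inclusion V)) (hcV w)).symm
      generalize D (W w) = q
      induction q using Quotient.inductionOn with | h γ
      refine congrArg Path.Homotopic.Quotient.mk (Path.ext (funext fun r => ?_))
      exact DFunLike.congr_fun (mapUE_comp_inclWU b) (γ r)
    · exact hc (Sum.inr ⟨p, hp⟩)
  obtain ⟨cX, hcXU, hcXV⟩ := hxX
  have hcX0 : cX (x 0 : X) = .refl _ := (hcXV (toV U V (x 0))).trans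
    (congrArg (fun q => Path.Homotopic.Quotient.map q (inclusion V)) hcV0)
  -- the cocycles on `U^E` and on `V` with values in the quotient
  let N := Subgroup.normalClosure (relators x a b)
  let θ := MulEquiv.ofBijective (theta x a)
    (theta_bijective hUc (injective_of_existsUnique hx) a)
  have hθ : ∀ u, theta x a (θ.symm u) = u := θ.apply_symm_apply
  have hθ' : ∀ w, θ.symm (theta x a w) = w := θ.symm_apply_apply
  let uE : FundamentalGroup (UE x) (UE.base x) →* FreeProd x ⧸ N :=
    (QuotientGroup.mk' N).comp ((embUB x).comp θ.symm.toMonoidHom)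
  let uV : FundamentalGroup ↥V (toV U V (x 0)) →* FreeProd x ⧸ N :=
    (QuotientGroup.mk' N).comp (embV x)
  -- The relators give this only on the range of `fromC`, which suffices since `D` was chosen to put
  -- the needed loops there.
  have hrel : ∀ h ∈ (fromC x).range, uE (i1E x h) = uV (i2E x b h) := by
    rintro _ ⟨g, rfl⟩
    exact QuotientGroup.eq.2 (Subgroup.subset_normalClosure ⟨g, _, hθ _, rfl⟩)
  have hWE : ∀ f : C(I, ↥(U ∩ V)), tree cE (E.comp ((toU U V).comp f)) =
      i1E x (tree D (W.comp f)) := fun f =>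
    tree_map (inclWU x) (c := D) (d := cE) (asPath (W.comp f)) (hcE _) (hcE _)
  have hWV : ∀ f : C(I, ↥(U ∩ V)), tree cV ((toV U V).comp f) =
      i2E x b (tree D (W.comp f)) := fun f =>
    tree_map (inclWV x b) (c := D) (d := cV) (asPath (W.comp f)) (hcV _) (hcV _)
  obtain ⟨χ, hχU, hχV⟩ := exists_glue hU hV hUV (((tree cE).push uE).comap E) ((tree cV).push uV)
    (by
      intro f hfU hfV
      let f' : C(I, ↥(U ∩ V)) := restrictRange f fun r => ⟨hfU r, hfV r⟩
      change uE (tree cE (E.comp ((toU U V).comp f'))) = uV (tree cV ((toV U V).comp f'))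
      rw [hWE, hWV]
      exact hrel _ (hDf f'))
  -- Gluing controls `χ` on `U` and `V` only. By `cocycle_eq` control on `U^E` reduces to the
  -- attached arcs, which run in `V` along `b j`; there `hrel` translates from `V` to `U^E`.
  have hχE : ∀ γ : Path (UE.base x) (UE.base x), χ ((mapUE b).comp γ) = uE (loop γ) := by
    intro γ
    rw [← tree_loop hcE0 γ]
    refine ArcAttach.cocycle_eq (Φ := χ.comap (mapUE b)) (Ψ := (tree cE).push uE)
      (fun f => hχU f) (fun j => ?_) γ
    have h1 := tree_map (inclWU x) (c := D) (d := cE) (ArcAttach.arc (fun _ : Fin n => x 0) (fun j => x j.succ) j)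
      (hcE _) (hcE _)
    have h2 := tree_map (inclWV x b) (c := D) (d := cV) (ArcAttach.arc (fun _ : Fin n => x 0) (fun j => x j.succ) j)
      (hcV _) (hcV _)
    have h3 := hrel _ (hDarc j)
    exact (hχV (b j)).trans ((congrArg uV h2).trans (h3.symm.trans (congrArg uE h1).symm))
  -- the two homomorphisms
  let Φ : FreeProd x ⧸ N →* FundamentalGroup X (x 0 : X) :=
    QuotientGroup.lift N (toX x a b) (normalClosure_relators_le_ker a b)
  have h1 : Φ.comp (χ.hom (x 0 : X)) = MonoidHom.id _ := by
    refine hom_ext fun γ => ?_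
    change χ.push Φ γ = loop γ
    rw [← tree_loop hcX0 γ]
    refine eq_of_local (O := fun k : Bool => bif k then U else V) ?_ ?_ ?_ γ
    · rintro (_ | _) <;> assumption
    · intro p
      rcases (hUV ▸ Set.mem_univ p : p ∈ U ∪ V) with hp | hp
      · exact ⟨true, hp⟩
      · exact ⟨false, hp⟩
    · rintro (_ | _) f hf
      · let f' : C(I, ↥V) := restrictRange f hf
        refine (congrArg Φ (hχV f')).trans ?_
        exact (tree_map (inclusion V) (c := cV) (d := cX) (asPath f') (hcXV _) (hcXV _)).symm
      · let f' : C(I, ↥U) := restrictRange f hf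
        refine (congrArg Φ (hχU f')).trans ?_
        change toX x a b (embUB x (θ.symm (tree cE (E.comp f')))) = _
        rw [toX_embUB, hθ]
        exact (tree_map (mapUE b) (c := cE) (d := cX) (asPath (E.comp f')) (hcXU _) (hcXU _)).symm
  have h2 : (χ.hom (x 0 : X)).comp Φ = MonoidHom.id _ := by
    refine QuotientGroup.monoidHom_ext _ (Monoid.Coprod.hom_ext
      (Monoid.Coprod.hom_ext (hom_ext fun γ => ?_) (hom_ext fun γ => ?_)) (hom_ext fun γ => ?_))
    · refine (hχE (γ.map E.continuous)).trans ?_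
      exact congrArg (fun w => (QuotientGroup.mk' N) (embUB x w))
        (hθ' (Monoid.Coprod.inl (loop γ)))
    · refine (hχV γ).trans ?_
      rw [push_apply, tree_loop hcV0]
      rfl
    · refine (hχE (γ.map (inclBU x a).continuous)).trans ?_
      exact congrArg (fun w => (QuotientGroup.mk' N) (embUB x w))
        (hθ' (Monoid.Coprod.inr (loop γ)))
  exact ⟨MonoidHom.toMulEquiv _ _ h1 h2⟩

end SplitCover

end

theorem theorem3p2 {X : Type*} [TopologicalSpace X] [PathConnectedSpace X]
    (U V : Set X) (hU : IsOpen U) (hV : IsOpen V) (hUV : U ∪ V = Set.univ)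
    (hUc : IsPathConnected U) (hVc : IsPathConnected V)
    (n : ℕ) (x : Fin (n + 1) → ↥(U ∩ V))
    (hx : ∀ y : ↥(U ∩ V), ∃! i : Fin (n + 1), y ∈ pathComponent (x i))
    (a : ∀ j : Fin n, Path (SplitCover.toU U V (x 0)) (SplitCover.toU U V (x j.succ)))
    (b : ∀ j : Fin n, Path (SplitCover.toV U V (x 0)) (SplitCover.toV U V (x j.succ))) :
    Function.Bijective (SplitCover.theta x a) ∧
    Nonempty (FundamentalGroup X (x 0 : X) ≃*
      SplitCover.FreeProd x ⧸ Subgroup.normalClosure (SplitCover.relators x a b)) :=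
  ⟨SplitCover.theta_bijective hUc (SplitCover.injective_of_existsUnique hx) a,
    SplitCover.nonempty_mulEquiv hU hV hUV hUc hVc hx a b⟩
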